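/- **Conventions.** All ordinals are smaller than $\omega^\omega$. For $\alpha>0$ with Cantor normal form $\alpha=\omega^{\beta_1}+\dots+\omega^{\beta_k}$, $\beta_1\ge\dots\ge\beta_k$, the (Cantor–Bendixson) rank is $\mathrm{rk}(\alpha)=\beta_k$; put $\mathrm{rk}(0)=0$. The place $\mathrm{pl}(\alpha)$ of $\alpha$ is the number of $j$ with $\beta_j=\beta_k$ if $\alpha\ge\omega$, and $\mathrm{pl}(\alpha)=\alpha+1$ if $\alpha<\omega$. Write $\beta\lhd\alpha$ if $\alpha=\beta+\omega^\gamma$ for some $\gamma\neq0$ with $\gamma>\mathrm{rk}(\beta)$. Let $T(\alpha)=\{\alpha\}\cup\{\beta:\beta\lhd\alpha\}$ and $T^{=l}(\alpha)=\{\beta\lhd\alpha:\mathrm{rk}(\beta)=l\}$, and call $\beta$ a child of $\alpha$ if $\alpha$ is the immediate $\lhd$-successor of $\beta$. For a set $J$ of ordinals, $\pi_J$ is the order isomorphism of $J$ onto its order type $\mathrm{otp}(J)$. **Large sets.** For natural numbers $k,r$ put $F(\omega^k)^r_k=\{\omega^k\}$ and, for $l<k$, let $F(\omega^k)^r_l$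 be the set of all $\gamma$ with $\mathrm{pl}(\gamma)>r$ that are a child of some $\beta\in F(\omega^k)^r_{l+1}$. For $\theta$ of rank $k$ and $l<k$ put $F(\theta)^r_l=\pi_{T(\theta)}^{-1}[F(\omega^k)^r_l]$. A set $A\subseteq T^{=l}(\theta)$ is $r$-large in $T^{=l}(\theta)$ if $F(\theta)^r_l\subseteq A$, and large if it is $r$-large for some $r\in\mathbb N$. **Skeletons and components.** Let $\delta<\omega^\omega$ have Cantor normal form $\delta=\omega^{\gamma_1}+\dots+\omega^{\gamma_{k}}$. A set $I\subseteq\delta$ is a *skeleton* of $\delta$ if $I$ is closed in $\delta$ in the order topology, $\mathrm{otp}(I)=\delta$, and for all $\alpha,\beta\in I$, $\alpha\lhd\beta$ if and only if $\pi_I(\alpha)\lhd\pi_I(\beta)$. For $\beta<\delta$ let $c(\beta)$ be the least $i\ge1$ with $\beta\le\omega^{\gamma_1}+\dots+\omega^{\gamma_i}$. For $1\le m\le k$ let $C_m=\{\beta<\delta:c(\beta)=m\}$ and $\epsilon_m=\sup C_m$ (so $\epsilon_m=0$ if $C_m=\emptyset$). **Canonical colourings.** Let $n\ge1$ and let $\chi:[\delta]^2\to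 n$ be a pair-colouring. * $\chi$ is *normal* if there is a function $D$ such that $\chi(\{\beta_1,\beta_2\})=D(c(\beta_2),\mathrm{rk}(\beta_2),\mathrm{rk}(\beta_1))$ whenever $\beta_1\lhd\beta_2<\delta$. * A colouring $f:\delta\to n$ is *$r$-good* if for every $\theta<\delta$ and $l<\mathrm{rk}(\theta)$ there is a colour $c$ such that $\{\alpha\in T^{=l}(\theta):f(\alpha)=c\}$ is $r$-large in $T^{=l}(\theta)$. A point $\alpha<\delta$ is *good* for $\chi$ if for some $r\in\mathbb N$ the colouring $\beta\mapsto\chi(\{\alpha,\beta\})$ (given some value at $\beta=\alpha$) is $r$-good. * $\chi$ is *uniformly good* if every $\alpha<\delta$ is good for $\chi$ and there is a function $E$ such that for every $\alpha<\delta$, every $1\le m\le k$ with $m\ne c(\alpha)$ and every $l<\mathrm{rk}(\epsilon_m)$, the set of those $\beta\in T^{=l}(\epsilon_m)$ with $\chi(\{\alpha,\beta\})=E(c(\alpha),\mathrm{rk}(\alpha))(m,l)$ is large in $T^{=l}(\epsilon_m)$. A skeleton $I$ of $\delta$ is *canonical* with respect to $\chi$ if the pair-colouring $\chi\circ\pi_I^{-1}:[\delta]^2\to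 n$ is both normal and uniformly good. **Proposition.** For every $\delta<\omega^\omega$, every positive integer $n$ and every pair-colouring $\chi:[\delta]^2\to n$, there is a skeleton $I$ of $\delta$ that is canonical with respect to $\chi$. -/

import Mathlib

open Set Ordinal

noncomputable section

namespace OrdinalSkeleton

/-! ### Cantor normal form, rank, place in fan -/

/-- The exponents `γ₁ ≥ γ₂ ≥ ⋯ ≥ γ_k` of the Cantor normal form
`α = ω ^ γ₁ + ω ^ γ₂ + ⋯ + ω ^ γ_k`, each exponent repeated according to its (finite)
multiplicity; Mathlib's `CNF ω α` lists the pairs (exponent, multiplicity) in decreasing order. -/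
def cnfExps (α : Ordinal.{0}) : List Ordinal.{0} :=
  (CNF ω α).flatMap fun p => List.replicate (Cardinal.toNat p.2.card) p.1

/-- The partial sum `ω ^ γ₁ + ⋯ + ω ^ γ_i` of the Cantor normal form of `δ`. -/
def cnfSum (δ : Ordinal.{0}) (i : ℕ) : Ordinal.{0} :=
  (((cnfExps δ).take i).map fun γ => ω ^ γ).sum

/-- Cantor–Bendixson rank: the last exponent of the Cantor normal form; the rank of `0` is `0`. -/
def cbRank (α : Ordinal.{0}) : Ordinal.{0} :=
  (cnfExps α).getLastD 0

/-- The coefficient of the last exponent of `α = ω ^ γ₁ * m₁ + ⋯ + ω ^ γ_l * m_l`; for finite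
ordinals the value is `α + 1` instead, so that `0` behaves like any other point of rank `0`. -/
def placeInFan (α : Ordinal.{0}) : Ordinal.{0} :=
  if α < ω then α + 1 else ((CNF ω α).map Prod.snd).getLastD 0

/-! ### The anti-tree order -/

/-- `β ◁ α`: `α = β + ω ^ γ` for some nonzero `γ` greater than the rank of `β`. -/
def TreeLT (β α : Ordinal.{0}) : Prop :=
  ∃ γ : Ordinal.{0}, γ ≠ 0 ∧ cbRank β < γ ∧ α = β + ω ^ γ

/-- `α` is the immediate successor of `β` in the anti-tree order. The set of all such `β` is the
fan below `α`. -/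
def TreeCov (β α : Ordinal.{0}) : Prop :=
  TreeLT β α ∧ ¬ ∃ γ, TreeLT β γ ∧ TreeLT γ α

/-- `T(α) = {α} ∪ {β | β ◁ α}`. -/
def subtree (α : Ordinal.{0}) : Set Ordinal.{0} :=
  {α} ∪ {β | TreeLT β α}

/-- `T^{=n}(α)`: the points `β ◁ α` of rank `n`. -/
def subtreeLevel (α n : Ordinal.{0}) : Set Ordinal.{0} :=
  {β | TreeLT β α ∧ cbRank β = n}

/-! ### Order types and collapsing maps -/

/-- Order type of a bounded set of ordinals, as an ordinal of the same universe. -/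
def otp (J : Set Ordinal.{0}) : Ordinal.{0} :=
  sInf {γ | Ordinal.lift.{1} γ = Ordinal.type (fun x y : J => x < y)}

theorem lift_otp {J : Set Ordinal.{0}} (hJ : BddAbove J) :
    Ordinal.lift.{1} (otp J) = Ordinal.type (fun x y : J => x < y) := by
  obtain ⟨b, hb⟩ := hJ
  have h1 : Ordinal.type (fun x y : J => x < y) ≤
      Ordinal.type (fun x y : Iio (Order.succ b) => x < y) :=
    Ordinal.type_le_iff'.2
      ⟨{ toFun := fun x => ⟨x.1, Order.lt_succ_of_le (hb x.2)⟩
         inj' := fun x y h => Subtype.ext (congrArg (fun z : Iio (Order.succ b) => z.1) h)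
         map_rel_iff' := Iff.rfl }⟩
  have h2 : Ordinal.type (fun x y : Iio (Order.succ b) => x < y) =
      Ordinal.lift.{1} (Order.succ b) := by
    simp
  rw [h2] at h1
  obtain ⟨γ, hγ⟩ := Ordinal.mem_range_lift_of_le h1
  exact csInf_mem (s := {γ | Ordinal.lift.{1} γ = Ordinal.type (fun x y : J => x < y)}) ⟨γ, hγ⟩

/-- On a bounded set `J` of ordinals, the order preserving bijection from `J` onto its order type:
it sends `α` to the order type of `{β ∈ J | β < α}`. -/
def collapse (J : Set Ordinal.{0}) (α : Ordinal.{0}) : Ordinal.{0} :=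
  otp (J ∩ Iio α)

/-! ### Skeletons -/

/-- `I` is a skeleton of `δ`. -/
structure IsSkeleton (δ : Ordinal.{0}) (I : Set Ordinal.{0}) : Prop where
  subset : I ⊆ Iio δ
  closed : IsClosed {x : Iio δ | (x : Ordinal.{0}) ∈ I}
  otp_eq : otp I = δ
  treeLT_iff : ∀ α ∈ I, ∀ β ∈ I, TreeLT α β ↔ TreeLT (collapse I α) (collapse I β)

/-! ### Components of the Cantor normal form -/

/-- The number `k_δ` of terms of the Cantor normal form of `δ`. -/
def numComponents (δ : Ordinal.{0}) : ℕ := (cnfExps δ).length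

/-- The index of the component of `β < δ`: the least `i ≥ 1` with `β ≤ ω ^ γ₁ + ⋯ + ω ^ γ_i`. -/
def componentIndex (δ β : Ordinal.{0}) : ℕ :=
  sInf {i : ℕ | 1 ≤ i ∧ β ≤ cnfSum δ i}

/-- The `i`-th component of `δ`. -/
def component (δ : Ordinal.{0}) (i : ℕ) : Set Ordinal.{0} :=
  {β | β < δ ∧ componentIndex δ β = i}

/-! ### Large sets -/

/-- `FanCore r κ n γ` means `γ ∈ F(ω ^ κ)^r_n`, where `F(ω ^ κ)^r_κ = {ω ^ κ}`, and, for `n < κ`,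
`F(ω ^ κ)^r_n` consists of the points `γ` of place greater than `r` in the fans below the points
of `F(ω ^ κ)^r_{n+1}`. -/
inductive FanCore (r : ℕ) (κ : Ordinal.{0}) : Ordinal.{0} → Ordinal.{0} → Prop
  | top : FanCore r κ κ (ω ^ κ)
  | step {n β γ : Ordinal.{0}} : FanCore r κ (n + 1) β → TreeCov γ β →
      (r : Ordinal.{0}) < placeInFan γ → FanCore r κ n γ

/-- `F(α)^r_n`: the preimage of `F(ω ^ k)^r_n`, where `k` is the rank of `α`, under the order
isomorphism of `T(α)` onto its order type `ω ^ k + 1` (for `k > 0`). -/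
def fanCore (α : Ordinal.{0}) (r : ℕ) (n : Ordinal.{0}) : Set Ordinal.{0} :=
  {β | β ∈ subtree α ∧ FanCore r (cbRank α) n (collapse (subtree α) β)}

/-- `r`-large subsets of `T^{=n}(α)`. -/
def IsLargeAt (α : Ordinal.{0}) (r : ℕ) (n : Ordinal.{0}) (A : Set Ordinal.{0}) : Prop :=
  A ⊆ subtreeLevel α n ∧ fanCore α r n ⊆ A

/-- Large subsets of `T^{=n}(α)`. For `n` less than the rank of `α` they form a proper filter
on `T^{=n}(α)`. -/
def IsLarge (α n : Ordinal.{0}) (A : Set Ordinal.{0}) : Prop :=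
  ∃ r : ℕ, IsLargeAt α r n A

/-! ### Canonical colourings

A pair-colouring of `δ` is given by a function on all unordered pairs; only its values on pairs of
two distinct elements of `δ` are ever used. Likewise for colourings of the points of `δ`. -/

/-- The colouring `f` of the points of `δ` is `r`-good. -/
def IsGoodColouring (δ : Ordinal.{0}) {n : ℕ} (f : Ordinal.{0} → Fin n) (r : ℕ) : Prop :=
  ∀ θ < δ, ∀ l < cbRank θ, ∃ c : Fin n, IsLargeAt θ r l {α ∈ subtreeLevel θ l | f α = c}

/-- The point `α` is good for the pair-colouring `col` of `δ`: for some `r`, the colouring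
`β ↦ col {α, β}` (with some value at `β = α`) is `r`-good. -/
def IsGoodPoint (δ : Ordinal.{0}) {n : ℕ} (col : Sym2 Ordinal.{0} → Fin n)
    (α : Ordinal.{0}) : Prop :=
  ∃ r : ℕ, ∃ f : Ordinal.{0} → Fin n,
    (∀ β < δ, β ≠ α → f β = col s(α, β)) ∧ IsGoodColouring δ f r

/-- `t` is the goodness function of `α`: for each component `m` other than that of `α`, with
supremum `ε`, and each `l` less than the rank of `ε`, `t m l` is the (necessarily unique) colour
`c` such that `col {α, β} = c` for a large set of `β` in `T^{=l}(ε)`. -/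
def IsGoodnessFunction (δ : Ordinal.{0}) {n : ℕ} (col : Sym2 Ordinal.{0} → Fin n)
    (α : Ordinal.{0}) (t : ℕ → Ordinal.{0} → Fin n) : Prop :=
  ∀ m : ℕ, 1 ≤ m → m ≤ numComponents δ → m ≠ componentIndex δ α →
    ∀ l < cbRank (sSup (component δ m)),
      IsLarge (sSup (component δ m)) l
        {β ∈ subtreeLevel (sSup (component δ m)) l | col s(α, β) = t m l}

/-- Normal pair-colourings of `δ`. -/
def IsNormalColouring (δ : Ordinal.{0}) {n : ℕ} (col : Sym2 Ordinal.{0} → Fin n) : Prop :=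
  ∃ D : ℕ → Ordinal.{0} → Ordinal.{0} → Fin n,
    ∀ β₁ < δ, ∀ β₂ < δ, TreeLT β₁ β₂ →
      col s(β₁, β₂) = D (componentIndex δ β₂) (cbRank β₂) (cbRank β₁)

/-- Uniformly good pair-colourings of `δ`. -/
def IsUniformlyGoodColouring (δ : Ordinal.{0}) {n : ℕ} (col : Sym2 Ordinal.{0} → Fin n) : Prop :=
  (∀ α < δ, IsGoodPoint δ col α) ∧
  ∃ D : ℕ → Ordinal.{0} → ℕ → Ordinal.{0} → Fin n,
    ∀ α < δ, IsGoodnessFunction δ col α (D (componentIndex δ α) (cbRank α))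

/-- The pair-colouring `col ∘ π⁻¹` of the order type of `I`, where `π` is the order preserving
bijection of `I` onto its order type. -/
def transport (I : Set Ordinal.{0}) {n : ℕ} (col : Sym2 Ordinal.{0} → Fin n) :
    Sym2 Ordinal.{0} → Fin n :=
  fun p => col (p.map (Function.invFunOn (collapse I) I))

/-- The skeleton `I` of `δ` is canonical with respect to `col`: it is normal and uniformly good. -/
def IsCanonicalSkeleton (δ : Ordinal.{0}) {n : ℕ} (col : Sym2 Ordinal.{0} → Fin n)
    (I : Set Ordinal.{0}) : Prop :=
  IsSkeleton δ I ∧ IsNormalColouring δ (transport I col) ∧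
    IsUniformlyGoodColouring δ (transport I col)

end OrdinalSkeleton

end

/-! For infinite `δ`, the Cantor normal form cuts `δ` into finitely many pieces of order type `ω ^
γ`. A point is named by a finite list: its piece, and then its position in each fan on the way down.
Under this naming `◁` becomes "proper descendant", the ordinal order becomes the post-order, and the
core of an `r`-large set consists of nodes reached by paths with all entries at least `r`. Hence
every self-map `e` of the tree that preserves roots, tails and the order of siblings yields a
skeleton (`IsCut.isSkeleton`). Closedness holds because the range of `e` contains all ancestors of
its members.

It remains to find an `e` on which the colouring is canonical (`exists_canonical_embedding`). Along
a fixed nonprincipal ultrafilter on `ℕ`, every colouring of nodes by finitely many colours has an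
iterated limit at each node and depth. A fusion, recursive along an enumeration of all nodes,
chooses each new child so that the colourings given by all earlier image nodes keep their iterated
limits (`exists_fusion`). So the colour of `e α` against a descendant of `e θ` depends only on `α`,
`θ` and the depth, once the entries of the path exceed a bound depending on `α` alone. This is
goodness.

Descendants of `α` are always enumerated after `α`, so `α` sees all its descendants at a given depth
in one colour, with no exceptions. This colour, and the limit of the colouring of `α` at each root,
are finitely many colourings of single nodes. Stabilising them in the same fusion makes them depend
only on the piece and the level of `α`, which gives normality and uniform goodness. For finite `δ`
there are no `◁`-pairs and `δ` itself serves. -/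

noncomputable section

namespace OrdinalSkeleton

/-! ### Fusion along an ultrafilter on the tree of finite sequences

A node of the tree is a list of natural numbers; the children of `l` are the lists `a :: l`. -/

section Fusion

open Filter Encodable

variable {C : Type} [Nonempty C]

/-- The limit of a sequence of colours along the hyperfilter. -/
def ulim (f : ℕ → C) : C :=
  Classical.epsilon fun c => ∀ᶠ x in (hyperfilter ℕ : Filter ℕ), f x = c

theorem eventually_eq_ulim [Finite C] (f : ℕ → C) :
    ∀ᶠ x in (hyperfilter ℕ : Filter ℕ), f x = ulim f := by
  have h : ∃ c : C, ∀ᶠ x in (hyperfilter ℕ : Filter ℕ), f x = c := by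
    by_contra hc
    rw [not_exists] at hc
    have h1 : ∀ c : C, ∀ᶠ x in (hyperfilter ℕ : Filter ℕ), f x ≠ c := fun c =>
      Ultrafilter.eventually_not.2 (hc c)
    obtain ⟨x, hx⟩ := (eventually_all.2 h1).exists
    exact hx (f x) rfl
  exact Classical.epsilon_spec (p := fun c => ∀ᶠ x in (hyperfilter ℕ : Filter ℕ), f x = c) h

/-- The iterated limit of the colours of the descendants of a node `j` levels below it. -/
def limAt (F : List ℕ → C) : ℕ → List ℕ → C
  | 0, l => F l
  | j + 1, l => ulim fun x => limAt F j (x :: l)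

/-- `h` is an admissible value at the child `x` of the image of `l`. -/
def FusionStep {ι : Type} (χ : List ℕ → List ℕ → C) (V : ι → List ℕ → C) (K : ℕ)
    (β : List ℕ) (h : ∀ α : List ℕ, encode α < encode β → List ℕ) (t : List ℕ) (x : ℕ) : Prop :=
  (∀ α (hα : encode α < encode β), (h α hα).headD 0 < x) ∧
  (∀ α (hα : encode α < encode β), ∀ j < K,
    limAt (χ (h α hα)) j (x :: t) = limAt (χ (h α hα)) (j + 1) t) ∧
  ∀ i, ∀ j < K, limAt (V i) j (x :: t) = limAt (V i) (j + 1) t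

theorem finite_encode_lt (m : ℕ) : {α : List ℕ | encode α < m}.Finite :=
  (Set.finite_Iio m).preimage (encode_injective.injOn)

/-- Only finitely many nodes precede `β`, so finitely many conditions are imposed, and each holds
for ultrafilter-many `x`. -/
theorem exists_fusionStep [Finite C] {ι : Type} [Finite ι] (χ : List ℕ → List ℕ → C)
    (V : ι → List ℕ → C) (K : ℕ) (β : List ℕ) (h : ∀ α : List ℕ, encode α < encode β → List ℕ)
    (t : List ℕ) : ∃ x, FusionStep χ V K β h t x := by
  have key : ∀ F : List ℕ → C, ∀ᶠ x in (hyperfilter ℕ : Filter ℕ), ∀ j < K,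
      limAt F j (x :: t) = limAt F (j + 1) t := fun F =>
    (eventually_all_finite (Set.finite_Iio K)).2 fun j _ =>
      eventually_eq_ulim fun x => limAt F j (x :: t)
  have := (finite_encode_lt (encode β)).to_subtype
  have h1 : ∀ᶠ x in (hyperfilter ℕ : Filter ℕ), ∀ α : {α : List ℕ | encode α < encode β},
      (h α.1 α.2).headD 0 < x := by
    refine eventually_all.2 fun α => ?_
    have := eventually_gt_atTop ((h α.1 α.2).headD 0)
    rw [← Nat.cofinite_eq_atTop] at this
    exact hyperfilter_le_cofinite this
  have h2 : ∀ᶠ x in (hyperfilter ℕ : Filter ℕ), ∀ α : {α : List ℕ | encode α < encode β},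
      ∀ j < K, limAt (χ (h α.1 α.2)) j (x :: t) = limAt (χ (h α.1 α.2)) (j + 1) t :=
    eventually_all.2 fun α => key _
  have h3 : ∀ᶠ x in (hyperfilter ℕ : Filter ℕ), ∀ i,
      ∀ j < K, limAt (V i) j (x :: t) = limAt (V i) (j + 1) t :=
    eventually_all.2 fun i => key _
  obtain ⟨x, hx1, hx2, hx3⟩ := (h1.and (h2.and h3)).exists
  exact ⟨x, fun α hα => hx1 ⟨α, hα⟩, fun α hα => hx2 ⟨α, hα⟩, hx3⟩

theorem encode_tail_lt (a : ℕ) (l : List ℕ) : encode l < encode (a :: l) := by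
  rw [encode_list_cons]
  exact Nat.lt_succ_of_le (Nat.right_le_pair _ _)

theorem lt_encode_cons (a : ℕ) (l : List ℕ) : a < encode (a :: l) := by
  rw [encode_list_cons]
  exact Nat.lt_succ_of_le (Nat.left_le_pair a (encode l))

theorem encode_cons_lt {a b : ℕ} (h : a < b) (l : List ℕ) :
    encode (a :: l) < encode (b :: l) := by
  rw [encode_list_cons, encode_list_cons]
  exact Nat.succ_lt_succ (Nat.pair_lt_pair_left _ h)

/-- A map of the tree into itself that preserves levels, the root, the nodes of level one, the
tail relation, and the order of siblings. -/
structure IsTreeEmbedding (e : List ℕ → List ℕ) : Prop where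
  nil : e [] = []
  singleton : ∀ m, e [m] = [m]
  cons : ∃ g : List ℕ → ℕ, (∀ a l, e (a :: l) = g (a :: l) :: e l) ∧
    ∀ l a b, a < b → g (a :: l) < g (b :: l)

/-- Well-founded recursion on codes: a node has a larger code than its tail and than its earlier
siblings, so both images are available when its own is chosen. Roots are left fixed, hence the
restriction to `l ≠ []`. -/
theorem exists_fusion [Finite C] {ι : Type} [Finite ι] (χ : List ℕ → List ℕ → C)
    (V : ι → List ℕ → C) (K : ℕ) :
    ∃ e : List ℕ → List ℕ, IsTreeEmbedding e ∧
      (∀ α a l, l ≠ [] → encode α < encode (a :: l) → ∀ j < K,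
        limAt (χ (e α)) j (e (a :: l)) = limAt (χ (e α)) (j + 1) (e l)) ∧
      ∀ i a l, l ≠ [] → ∀ j < K,
        limAt (V i) j (e (a :: l)) = limAt (V i) (j + 1) (e l) := by
  let step : ∀ β : List ℕ, (∀ α : List ℕ, encode α < encode β → List ℕ) → List ℕ := fun β =>
    match β with
    | [] => fun _ => []
    | [m] => fun _ => [m]
    | a :: b :: l => fun h =>
      (exists_fusionStep χ V K (a :: b :: l) h (h (b :: l) (encode_tail_lt _ _))).choose ::
        h (b :: l) (encode_tail_lt _ _)
  let e : List ℕ → List ℕ := (measure (encode : List ℕ → ℕ)).wf.fix step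
  have he : ∀ β, e β = step β fun α _ => e α := fun β =>
    (measure (encode : List ℕ → ℕ)).wf.fix_eq step β
  have h0 : e [] = [] := he []
  have h1 : ∀ m, e [m] = [m] := fun m => he [m]
  have h2 : ∀ a l, l ≠ [] → ∃ x, e (a :: l) = x :: e l ∧
      FusionStep χ V K (a :: l) (fun α _ => e α) (e l) x := by
    rintro a (_ | ⟨b, l⟩) hl
    · exact absurd rfl hl
    · exact ⟨_, he (a :: b :: l), (exists_fusionStep χ V K (a :: b :: l) (fun α _ => e α)
        (e (b :: l))).choose_spec⟩
  have h3 : ∀ a l, e (a :: l) = (e (a :: l)).headD 0 :: e l := by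
    intro a l
    rcases eq_or_ne l [] with rfl | hl
    · rw [h1, h0]; rfl
    · obtain ⟨x, hx, -⟩ := h2 a l hl
      rw [hx]; rfl
  refine ⟨e, ⟨h0, h1, fun l => (e l).headD 0, h3, fun l a b hab => ?_⟩, ?_, ?_⟩
  · rcases eq_or_ne l [] with rfl | hl
    · simpa only [h1, List.headD_cons] using hab
    · obtain ⟨x, hx, hx'⟩ := h2 b l hl
      -- The new entry exceeds the heads of all earlier images, in particular that of the smaller
      -- sibling.
      have := hx'.1 (a :: l) (encode_cons_lt hab l)
      simpa only [hx, List.headD_cons] using this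
  · intro α a l hl hα j hj
    obtain ⟨x, hx, hx'⟩ := h2 a l hl
    rw [hx]
    exact hx'.2.1 α hα j hj
  · intro i a l hl j hj
    obtain ⟨x, hx, hx'⟩ := h2 a l hl
    rw [hx]
    exact hx'.2.2 i j hj

/-- Each entry removed from the path is traded for one more limit. The predicate `p` records which
one-step extensions are known to be stable. -/
theorem limAt_append {F : List ℕ → C} {e : List ℕ → List ℕ} {K : ℕ} {p : ℕ → List ℕ → Prop}
    (h : ∀ a l, l ≠ [] → p a l → ∀ j < K, limAt F j (e (a :: l)) = limAt F (j + 1) (e l))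
    {θ : List ℕ} (hθ : θ ≠ []) (u : List ℕ) (j : ℕ) (hj : j + u.length ≤ K)
    (hp : ∀ a l, a :: l <:+ u → p a (l ++ θ)) :
    limAt F j (e (u ++ θ)) = limAt F (j + u.length) (e θ) := by
  induction u generalizing j with
  | nil => rfl
  | cons a u ih =>
    rw [List.length_cons] at hj ⊢
    rw [List.cons_append, h a (u ++ θ) (by simp [hθ]) (hp a u (List.suffix_refl _)) j (by omega),
      ih (j + 1) (by omega) fun b l hl => hp b l (hl.trans (List.suffix_cons _ _))]
    congr 1
    omega

/-- Every colouring of pairs of nodes is canonical, up to height `K` and on the first `M` subtrees,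
on the range of a tree embedding. -/
theorem exists_canonical_embedding [Finite C] (χ : List ℕ → List ℕ → C) (K M : ℕ) :
    ∃ e : List ℕ → List ℕ, IsTreeEmbedding e ∧
      ∃ (c : List ℕ → List ℕ → ℕ → C) (D : ℕ → ℕ → ℕ → C) (E : ℕ → ℕ → ℕ → ℕ → C),
      (∀ α, ∃ r : ℕ, ∀ θ ≠ [], ∀ u : List ℕ, u.length ≤ K → (∀ a ∈ u, r ≤ a) →
        χ (e α) (e (u ++ θ)) = c α θ u.length) ∧
      (∀ m s u, s.length ≤ K → u.length ≤ K →
        χ (e (s ++ [m])) (e (u ++ (s ++ [m]))) = D m s.length u.length) ∧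
      (∀ m s, s.length ≤ K → ∀ m' < M, ∀ j ≤ K, c (s ++ [m]) [m'] j = E m s.length m' j) := by
  -- Auxiliary colourings of single nodes: `none` takes the limit of the colouring of `α` below `α`
  -- itself, `some m` its limit below the root `[m]`.
  let V : Option (Fin M) × Fin (K + 1) → List ℕ → C := fun q α =>
    limAt (χ α) q.2 (q.1.elim α fun m => [m.1])
  obtain ⟨e, he, hχ, hV⟩ := exists_fusion χ V K
  have hV' : ∀ q m s, s.length ≤ K → V q (e (s ++ [m])) = limAt (V q) s.length [m] := by
    intro q m s hs
    have := limAt_append (F := V q) (e := e) (K := K) (p := fun _ _ => True)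
      (fun a l hl _ => hV q a l hl) (List.cons_ne_nil m []) s 0 (by omega) (by simp)
    rw [Nat.zero_add, he.singleton] at this
    exact this
  refine ⟨e, he, fun α θ j => limAt (χ (e α)) j (e θ),
    fun m i j => if hj : j < K + 1 then limAt (V (none, ⟨j, hj⟩)) i [m] else Classical.arbitrary C,
    fun m i m' j => if h : m' < M ∧ j < K + 1 then
      limAt (V (some ⟨m', h.1⟩, ⟨j, h.2⟩)) i [m] else Classical.arbitrary C, ?_, ?_, ?_⟩
  -- The bound works for all `θ` at once, since the code of a node exceeds its first entry.
  · refine fun α => ⟨encode α, fun θ hθ u huK hr => ?_⟩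
    have hlt : ∀ a l, a :: l <:+ u → encode α < encode (a :: (l ++ θ)) := fun a l hl =>
      (hr a (hl.subset List.mem_cons_self)).trans_lt (lt_encode_cons _ _)
    have := limAt_append (F := χ (e α)) (e := e) (K := K)
      (p := fun a l => encode α < encode (a :: l))
      (fun a l hl h => hχ α a l hl h) hθ u 0 (by omega) hlt
    rwa [Nat.zero_add] at this
  · intro m s u hs hu
    have hlt : ∀ a l, a :: l <:+ u → encode (s ++ [m]) < encode (a :: (l ++ (s ++ [m]))) := by
      intro a l _
      refine lt_of_le_of_lt ?_ (encode_tail_lt _ _)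
      clear * -
      induction l with
      | nil => exact le_rfl
      | cons b l ih => exact ih.trans (encode_tail_lt _ _).le
    have := limAt_append (F := χ (e (s ++ [m]))) (e := e) (K := K)
      (p := fun a l => encode (s ++ [m]) < encode (a :: l))
      (fun a l hl h => hχ _ a l hl h) (by simp) u 0 (by omega) hlt
    rw [Nat.zero_add] at this
    beta_reduce
    rw [dif_pos (by omega), ← hV' _ _ _ hs]
    exact this
  · intro m s hs m' hm' j hj
    beta_reduce
    rw [dif_pos ⟨hm', Nat.lt_succ_of_le hj⟩, ← hV' _ _ _ hs, he.singleton]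
    rfl

end Fusion

/-! ### Rank, place and the anti-tree order through the last term of `1 + β` -/

theorem omega0_opow_pos (k : Ordinal.{0}) : 0 < ω ^ k := opow_pos k omega0_pos

theorem omega0_opow_mul_inj {k x y : Ordinal.{0}} : ω ^ k * x = ω ^ k * y ↔ x = y :=
  ⟨fun h => by
    rw [← mul_div_cancel x (omega0_opow_pos k).ne', h, mul_div_cancel y (omega0_opow_pos k).ne'],
    fun h => by rw [h]⟩

theorem omega0_opow_mul_nat_lt_succ (k : Ordinal.{0}) (n : ℕ) : ω ^ k * n < ω ^ (k + 1) :=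
  opow_mul_lt_opow (natCast_lt_omega0 n) (Order.lt_add_one_iff.2 le_rfl)

theorem omega0_opow_dvd_add_mul {k b : Ordinal.{0}} (h : ω ^ (k + 1) ∣ b) (x : Ordinal.{0}) :
    ω ^ k ∣ b + ω ^ k * x :=
  (dvd_add_iff ((opow_dvd_opow ω le_self_add).trans h)).2 (dvd_mul_right _ _)

theorem omega0_opow_succ_dvd_of_lt {e E : Ordinal.{0}} (h : e < E) : ω ^ (e + 1) ∣ ω ^ E :=
  opow_dvd_opow ω (Order.add_one_le_of_lt h)

/-- After division by `ω ^ k`, a successor would be a multiple of `ω`. -/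
theorem not_omega0_opow_succ_dvd {b k : Ordinal.{0}} (h : ω ^ k ∣ b) :
    ¬ ω ^ (k + 1) ∣ b + ω ^ k := by
  obtain ⟨q, rfl⟩ := h
  rintro ⟨x, hx⟩
  rw [← mul_add_one, opow_add_one, mul_assoc, omega0_opow_mul_inj] at hx
  have h1 : Order.IsSuccPrelimit (q + 1) := isSuccPrelimit_iff_omega0_dvd.2 ⟨x, hx⟩
  exact Order.not_isSuccPrelimit_succ q h1

theorem add_omega0_opow_inj {b b' k k' : Ordinal.{0}} (hb : ω ^ k ∣ b) (hb' : ω ^ k' ∣ b')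
    (h : b + ω ^ k = b' + ω ^ k') : k = k' ∧ b = b' := by
  have hk : k = k' := by
    rcases lt_trichotomy k k' with hlt | heq | hlt
    · refine absurd ?_ (not_omega0_opow_succ_dvd hb)
      have h2 := omega0_opow_succ_dvd_of_lt hlt
      rw [h]
      exact (dvd_add_iff (h2.trans hb')).2 h2
    · exact heq
    · refine absurd ?_ (not_omega0_opow_succ_dvd hb')
      have h2 := omega0_opow_succ_dvd_of_lt hlt
      rw [← h]
      exact (dvd_add_iff (h2.trans hb)).2 h2
  subst hk
  obtain ⟨q, rfl⟩ := hb
  obtain ⟨q', rfl⟩ := hb'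
  rw [← mul_add_one, ← mul_add_one, omega0_opow_mul_inj] at h
  exact ⟨rfl, by rw [Order.succ_injective h]⟩

theorem add_omega0_opow_mul_inj {b b' k k' : Ordinal.{0}} {a a' : ℕ} (hb : ω ^ (k + 1) ∣ b)
    (hb' : ω ^ (k' + 1) ∣ b') (h : b + ω ^ k * a + ω ^ k = b' + ω ^ k' * a' + ω ^ k') :
    k = k' ∧ a = a' ∧ b = b' := by
  obtain ⟨rfl, h2⟩ := add_omega0_opow_inj
    (omega0_opow_dvd_add_mul hb _)
    (omega0_opow_dvd_add_mul hb' _) h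
  have hlt : ∀ n : ℕ, ω ^ k * n < ω ^ (k + 1) := omega0_opow_mul_nat_lt_succ k
  obtain ⟨q, rfl⟩ := hb
  obtain ⟨q', rfl⟩ := hb'
  have hm := congrArg (· % ω ^ (k + 1)) h2
  simp only [mul_add_mod_self, mod_eq_of_lt (hlt _)] at hm
  have hd := congrArg (· / ω ^ (k + 1)) h2
  simp only [mul_add_div _ (omega0_opow_pos _).ne', div_eq_zero_of_lt (hlt _), add_zero] at hd
  rw [omega0_opow_mul_inj, Nat.cast_inj] at hm
  exact ⟨rfl, hm, by rw [hd]⟩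

/-- Links the list definition of rank and place to arithmetic: the last block, with one copy of its
power split off. -/
theorem exists_CNF_eq_append {o : Ordinal.{0}} (ho : o ≠ 0) :
    ∃ (L : List (Ordinal × Ordinal)) (b e : Ordinal.{0}) (c : ℕ),
      CNF ω o = L ++ [(e, ((c + 1 : ℕ) : Ordinal))] ∧ ω ^ (e + 1) ∣ b ∧
      o = b + ω ^ e * c + ω ^ e := by
  induction o using CNF.rec ω with
  | H0 => exact absurd rfl ho
  | H o _ ih =>
    obtain ⟨c, hc⟩ := lt_omega0.1 (div_opow_log_lt o one_lt_omega0)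
    have hc0 := div_opow_log_pos ω ho
    rw [hc] at hc0
    have hdm := div_add_mod o (ω ^ log ω o)
    rw [CNF.ne_zero ho, hc]
    rw [hc] at hdm
    by_cases hr : o % ω ^ log ω o = 0
    · rw [hr, CNF.zero_right]
      obtain ⟨d, rfl⟩ := Nat.exists_eq_succ_of_ne_zero (n := c) (by rintro rfl; simp at hc0)
      refine ⟨[], 0, log ω o, d, rfl, dvd_zero _, ?_⟩
      rw [hr, add_zero] at hdm
      rw [zero_add, ← mul_add_one]
      exact_mod_cast hdm.symm
    · obtain ⟨L, b, e, d, h1, h2, h3⟩ := ih hr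
      have hlt : e < log ω o := by
        have h4 : ω ^ e ≤ o % ω ^ log ω o := by rw [h3]; exact le_add_self
        exact (opow_lt_opow_iff_right one_lt_omega0).1
          (h4.trans_lt (mod_lt _ (omega0_opow_pos _).ne'))
      refine ⟨(log ω o, (c : Ordinal)) :: L, ω ^ log ω o * c + b, e, d, by rw [h1]; rfl,
        (dvd_add_iff ((omega0_opow_succ_dvd_of_lt hlt).trans (dvd_mul_right _ _))).2 h2, ?_⟩
      rw [add_assoc, add_assoc, ← add_assoc b, ← h3, hdm]

theorem cbRank_eq_of_CNF {o : Ordinal.{0}} {L : List (Ordinal × Ordinal)} {e : Ordinal.{0}} {c : ℕ}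
    (h : CNF ω o = L ++ [(e, ((c + 1 : ℕ) : Ordinal))]) : cbRank o = e := by
  rw [cbRank, cnfExps, h, List.flatMap_append, List.flatMap_singleton, card_nat,
    Cardinal.toNat_natCast, List.replicate_succ', ← List.append_assoc, List.getLastD_concat]

theorem cbRank_natCast (n : ℕ) : cbRank n = 0 := by
  cases n with
  | zero => rw [Nat.cast_zero, cbRank, cnfExps, CNF.zero_right]; rfl
  | succ m =>
    obtain ⟨L, b, e, c, h1, h2, h3⟩ := exists_CNF_eq_append (o := ((m + 1 : ℕ) : Ordinal.{0}))
      (by exact_mod_cast m.succ_ne_zero)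
    rw [cbRank_eq_of_CNF h1]
    refine (add_omega0_opow_inj (b' := (m : Ordinal)) (k' := 0)
      (omega0_opow_dvd_add_mul h2 c) (by simp) ?_).1
    rw [← h3]
    simp

/-- `1 + β = b + ω ^ k` where `b` is a multiple of `ω ^ k`. -/
structure LastTerm (β b k : Ordinal.{0}) : Prop where
  dvd : ω ^ k ∣ b
  eq : 1 + β = b + ω ^ k

theorem exists_lastTerm (β : Ordinal.{0}) : ∃ b k, LastTerm β b k := by
  obtain ⟨L, b, e, c, -, h2, h3⟩ := exists_CNF_eq_append (o := 1 + β) (by simp)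
  exact ⟨_, e, omega0_opow_dvd_add_mul h2 _, h3⟩

theorem lastTerm_natCast (n : ℕ) : LastTerm n n 0 :=
  ⟨by simp, by rw [opow_zero]; exact_mod_cast Nat.add_comm 1 n⟩

/-- Passing to `1 + β` changes nothing for infinite `β` and turns finite `β`, including `0`, into
positive successors, so that `0` needs no separate treatment. -/
theorem LastTerm.cbRank {β b k : Ordinal.{0}} (h : LastTerm β b k) : cbRank β = k := by
  rcases lt_or_ge β ω with hβ | hβ
  · obtain ⟨n, rfl⟩ := lt_omega0.1 hβ
    rw [cbRank_natCast]
    have h2 := lastTerm_natCast n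
    exact (add_omega0_opow_inj h2.dvd h.dvd (h2.eq.symm.trans h.eq)).1
  · obtain ⟨L, b', e, c, h1, h2, h3⟩ := exists_CNF_eq_append (o := β)
      (omega0_pos.trans_le hβ).ne'
    rw [cbRank_eq_of_CNF h1]
    refine (add_omega0_opow_inj (omega0_opow_dvd_add_mul h2 c)
      h.dvd ?_).1
    rw [← h.eq, one_add_of_omega0_le hβ, ← h3]

theorem placeInFan_eq {β b k : Ordinal.{0}} {a : ℕ} (hb : ω ^ (k + 1) ∣ b)
    (h : 1 + β = b + ω ^ k * a + ω ^ k) : placeInFan β = ((a + 1 : ℕ) : Ordinal) := by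
  rcases lt_or_ge β ω with hβ | hβ
  · rw [placeInFan, if_pos hβ]
    obtain ⟨n, rfl⟩ := lt_omega0.1 hβ
    obtain ⟨-, h2, -⟩ := add_omega0_opow_mul_inj (b' := 0) (k' := 0) (a' := n) hb (dvd_zero _)
      (h.symm.trans (by
        rw [opow_zero, one_mul, zero_add]
        exact_mod_cast Nat.add_comm 1 n))
    rw [h2]
    norm_cast
  · rw [placeInFan, if_neg hβ.not_gt]
    obtain ⟨L, b', e, c, h1, h2, h3⟩ := exists_CNF_eq_append (o := β)
      (omega0_pos.trans_le hβ).ne'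
    rw [one_add_of_omega0_le hβ, h3] at h
    rw [h1, (add_omega0_opow_mul_inj h2 hb h).2.1, List.map_append, List.map_singleton,
      List.getLastD_concat]

theorem LastTerm.pos {β b k : Ordinal.{0}} (h : LastTerm β b k) : b < 1 + β := by
  rw [h.eq]
  exact lt_add_of_pos_right _ (omega0_opow_pos k)

theorem exists_natCast_of_lt_opow_succ {b k ξ : Ordinal.{0}} (h1 : b < ξ)
    (h2 : ξ < b + ω ^ (k + 1)) :
    ∃ a : ℕ, b + ω ^ k * a < ξ ∧ ξ ≤ b + ω ^ k * a + ω ^ k := by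
  classical
  have hex : ∃ n : ℕ, ξ ≤ b + ω ^ k * n := by
    obtain ⟨ν, rfl⟩ := exists_add_of_le h1.le
    obtain ⟨n, hn⟩ := lt_omega0_opow_succ.1 ((add_lt_add_iff_left b).1 h2)
    exact ⟨n, by gcongr⟩
  obtain ⟨a, ha⟩ := Nat.exists_eq_succ_of_ne_zero (n := Nat.find hex) fun h0 => by
    have := Nat.find_spec hex
    rw [h0, Nat.cast_zero, mul_zero, add_zero] at this
    exact this.not_gt h1
  refine ⟨a, not_le.1 (Nat.find_min hex (by omega)), ?_⟩
  have := Nat.find_spec hex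
  rwa [ha, Nat.cast_succ, mul_add_one, ← add_assoc] at this

/-- In the coordinate `1 + β`, the points below `α` in the anti-tree order fill the interval between
`b` and `b + ω ^ k`. This reduces `◁` to order comparisons. -/
theorem LastTerm.treeLT_iff {α β b k : Ordinal.{0}} (h : LastTerm α b k) :
    TreeLT β α ↔ b < 1 + β ∧ β < α := by
  obtain ⟨b', j, hβ⟩ := exists_lastTerm β
  rw [TreeLT, hβ.cbRank]
  constructor
  · rintro ⟨γ, hγ, hj, rfl⟩
    have h1 : 1 + (β + ω ^ γ) = b' + ω ^ γ := by
      rw [← add_assoc, hβ.eq, add_assoc,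
        add_omega0_opow ((opow_lt_opow_iff_right one_lt_omega0).2 hj)]
    -- Adding `ω ^ γ` absorbs the remainder of `b'`, so the base of the sum is `b'` rounded down to
    -- a multiple of `ω ^ γ`.
    have h2 : ω ^ γ * (b' / ω ^ γ) + ω ^ γ = b' + ω ^ γ := by
      conv_rhs => rw [← div_add_mod b' (ω ^ γ), add_assoc,
        add_omega0_opow (mod_lt b' (omega0_opow_pos γ).ne')]
    obtain ⟨rfl, rfl⟩ := add_omega0_opow_inj h.dvd (dvd_mul_right _ _)
      ((h.eq.symm.trans h1).trans h2.symm)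
    exact ⟨(mul_div_le _ _).trans_lt hβ.pos, lt_add_of_pos_right _ (omega0_opow_pos _)⟩
  · rintro ⟨h1, h2⟩
    have h3 : 1 + β < b + ω ^ k := h.eq ▸ (add_lt_add_iff_left 1).2 h2
    obtain ⟨ν, hν⟩ := exists_add_of_le h1.le
    have hν0 : ν ≠ 0 := by rintro rfl; rw [add_zero] at hν; exact h1.ne' hν
    rw [hν, add_lt_add_iff_left] at h3
    refine ⟨k, ?_, ?_, ?_⟩
    · rintro rfl
      rw [opow_zero, Order.lt_one_iff] at h3
      exact hν0 h3
    · by_contra! hjk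
      have h4 : ω ^ k ∣ b + ν := by
        rw [← hν, hβ.eq]
        exact (dvd_add_iff ((opow_dvd_opow ω hjk).trans hβ.dvd)).2 (opow_dvd_opow ω hjk)
      exact (le_of_dvd hν0 ((dvd_add_iff h.dvd).1 h4)).not_gt h3
    · rw [← add_right_inj (1 : Ordinal.{0}), h.eq, ← add_assoc, hν, add_assoc, add_omega0_opow h3]

theorem LastTerm.mem_subtree_iff {α β b k : Ordinal.{0}} (h : LastTerm α b k) :
    β ∈ subtree α ↔ b < 1 + β ∧ β ≤ α := by
  rw [subtree, mem_union, mem_singleton_iff, mem_ofPred_eq, h.treeLT_iff]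
  constructor
  · rintro (rfl | h1)
    · exact ⟨h.pos, le_rfl⟩
    · exact ⟨h1.1, h1.2.le⟩
  · rintro ⟨h1, h2⟩
    rcases h2.eq_or_lt with h3 | h3
    · exact Or.inl h3
    · exact Or.inr ⟨h1, h3⟩

theorem exists_one_add_eq {ξ : Ordinal.{0}} (h : 0 < ξ) : ∃ β, ξ = 1 + β :=
  exists_add_of_le (Order.one_le_iff_pos.2 h)

/-- The interval below `α` splits into blocks of length `ω ^ k`. A point that is not the right end
of its block has that end strictly between itself and `α`. -/
theorem exists_of_treeCov {α γ b k : Ordinal.{0}} (h : LastTerm α b (k + 1)) (hc : TreeCov γ α) :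
    ∃ a : ℕ, 1 + γ = b + ω ^ k * a + ω ^ k := by
  obtain ⟨h1, h2⟩ := hc
  obtain ⟨h3, h4⟩ := h.treeLT_iff.1 h1
  have h5 : 1 + γ < b + ω ^ (k + 1) := h.eq ▸ (add_lt_add_iff_left 1).2 h4
  obtain ⟨a, ha1, ha2⟩ := exists_natCast_of_lt_opow_succ h3 h5
  refine ⟨a, ha2.eq_or_lt.resolve_right fun hlt => h2 ?_⟩
  obtain ⟨β, hβ⟩ := exists_one_add_eq
    (lt_of_lt_of_le (omega0_opow_pos k) (le_add_self (a := ω ^ k) (b := b + ω ^ k * a)))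
  have hβ' : LastTerm β (b + ω ^ k * a) k :=
    ⟨omega0_opow_dvd_add_mul h.dvd _, hβ.symm⟩
  refine ⟨β, hβ'.treeLT_iff.2 ⟨ha1, (add_lt_add_iff_left 1).1 (hβ ▸ hlt)⟩, h.treeLT_iff.2 ⟨?_, ?_⟩⟩
  · exact lt_of_le_of_lt le_self_add hβ'.pos
  · rw [← add_lt_add_iff_left 1, h.eq, ← hβ, add_assoc, ← mul_add_one, add_lt_add_iff_left]
    exact_mod_cast omega0_opow_mul_nat_lt_succ k (a + 1)

/-! ### Collapsing maps -/

theorem otp_image {f : Ordinal.{0} → Ordinal.{0}} {δ : Ordinal.{0}} (hf : StrictMonoOn f (Iio δ)) :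
    otp (f '' Iio δ) = δ := by
  have h : Ordinal.lift.{1} δ = Ordinal.type (fun x y : f '' Iio δ => x < y) := by
    have h2 : Ordinal.type (fun x y : Iio δ => x < y) = Ordinal.lift.{1} δ := by simp
    rw [← h2]
    exact type_eq.2 ⟨(hf.orderIso f (Iio δ)).toRelIsoLT⟩
  have hbdd : {γ | Ordinal.lift.{1} γ = Ordinal.type (fun x y : f '' Iio δ => x < y)} = {δ} := by
    ext γ
    rw [mem_ofPred_eq, ← h, lift_inj, mem_singleton_iff]
  rw [otp, hbdd, csInf_singleton]

theorem collapse_image {f : Ordinal.{0} → Ordinal.{0}} {δ β : Ordinal.{0}}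
    (hf : StrictMonoOn f (Iio δ)) (hβ : β < δ) : collapse (f '' Iio δ) (f β) = β := by
  have h : f '' Iio δ ∩ Iio (f β) = f '' Iio β := by
    ext x
    constructor
    · rintro ⟨⟨y, hy, rfl⟩, hlt⟩
      exact ⟨y, (hf.lt_iff_lt hy hβ).1 hlt, rfl⟩
    · rintro ⟨y, hy, rfl⟩
      exact ⟨⟨y, hy.trans hβ, rfl⟩, hf (hy.trans hβ) hβ hy⟩
  rw [collapse, h, otp_image (hf.mono (Iio_subset_Iio hβ.le))]

/-- In the shifted coordinate `T(α)` is an interval starting just after `b`, so its collapse is left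
subtraction of `b`. -/
theorem LastTerm.add_collapse {α β b k : Ordinal.{0}} (h : LastTerm α b k) (hβ : β ∈ subtree α) :
    b + (1 + collapse (subtree α) β) = 1 + β := by
  have hs : ∀ ν : Ordinal.{0}, 1 + (b + (1 + ν) - 1) = b + (1 + ν) := fun ν =>
    Ordinal.add_sub_cancel_of_le (le_self_add.trans le_add_self)
  have hf : StrictMonoOn (fun ν : Ordinal.{0} => b + (1 + ν) - 1) (Iio (ω ^ k - 1 + 1)) := by
    intro x _ y _ hxy
    rw [← add_lt_add_iff_left 1, hs, hs]
    gcongr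
  have h1 : (1 : Ordinal.{0}) + (ω ^ k - 1) = ω ^ k :=
    Ordinal.add_sub_cancel_of_le (Order.one_le_iff_pos.2 (omega0_opow_pos k))
  have hsub : ∀ γ ∈ subtree α, ∃ ν < ω ^ k - 1 + 1, 1 + γ = b + (1 + ν) := by
    intro γ hγ
    obtain ⟨h2, h3⟩ := h.mem_subtree_iff.1 hγ
    obtain ⟨μ, hμ⟩ := exists_add_of_le h2.le
    have hμ0 : 0 < μ := by
      rw [hμ] at h2
      exact (lt_add_iff_pos_right b).1 h2
    obtain ⟨ν, rfl⟩ := exists_one_add_eq hμ0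
    refine ⟨ν, Order.lt_add_one_iff.2 ?_, hμ⟩
    rwa [← add_le_add_iff_left 1, h1, ← add_le_add_iff_left b, ← hμ, ← h.eq, add_le_add_iff_left]
  have himage : subtree α = (fun ν : Ordinal.{0} => b + (1 + ν) - 1) '' Iio (ω ^ k - 1 + 1) := by
    ext γ
    constructor
    · intro hγ
      obtain ⟨ν, h2, h3⟩ := hsub γ hγ
      exact ⟨ν, h2, Ordinal.sub_eq_of_add_eq h3⟩
    · rintro ⟨ν, h2, rfl⟩
      rw [h.mem_subtree_iff, hs]
      refine ⟨lt_add_of_pos_right _ (zero_lt_one.trans_le le_self_add), ?_⟩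
      rw [← add_le_add_iff_left 1, hs, h.eq, add_le_add_iff_left, ← h1, add_le_add_iff_left]
      exact Order.lt_add_one_iff.1 h2
  obtain ⟨ν, h2, h3⟩ := hsub β hβ
  have h4 : β = b + (1 + ν) - 1 := (Ordinal.sub_eq_of_add_eq h3).symm
  have h5 := collapse_image hf h2
  rw [← himage] at h5
  rw [h3, h4]
  exact congrArg (fun x => b + (1 + x)) h5

/-! ### The post-order on the tree of finite sequences -/

/-- `l` precedes `l'` in the post-order: it is a proper descendant of `l'`, or belongs to an
earlier branch. -/
def NodeLT (l l' : List ℕ) : Prop :=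
  (∃ u ≠ [], l = u ++ l') ∨ ∃ u v a b t, a < b ∧ l = u ++ a :: t ∧ l' = v ++ b :: t

theorem NodeLT.append {l l' : List ℕ} (h : NodeLT l l') (s : List ℕ) : NodeLT (l ++ s) (l' ++ s) := by
  rcases h with ⟨u, hu, rfl⟩ | ⟨u, v, a, b, t, hab, rfl, rfl⟩
  · exact Or.inl ⟨u, hu, by simp⟩
  · exact Or.inr ⟨u, v, a, b, t ++ s, hab, by simp, by simp⟩

theorem nodeLT_trichotomy (l l' : List ℕ) : l = l' ∨ NodeLT l l' ∨ NodeLT l' l := by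
  induction l using List.reverseRecOn generalizing l' with
  | nil =>
    rcases eq_or_ne l' [] with rfl | h
    · exact Or.inl rfl
    · exact Or.inr (Or.inr (Or.inl ⟨l', h, by simp⟩))
  | append_singleton l x ih =>
    rcases List.eq_nil_or_concat' l' with rfl | ⟨l', y, rfl⟩
    · exact Or.inr (Or.inl (Or.inl ⟨l ++ [x], by simp, by simp⟩))
    · rcases lt_trichotomy x y with h | rfl | h
      · exact Or.inr (Or.inl (Or.inr ⟨l, l', x, y, [], h, rfl, rfl⟩))
      · rcases ih l' with rfl | h | h
        · exact Or.inl rfl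
        · exact Or.inr (Or.inl (h.append [x]))
        · exact Or.inr (Or.inr (h.append [x]))
      · exact Or.inr (Or.inr (Or.inr ⟨l', l, y, x, [], h, rfl, rfl⟩))

theorem IsTreeEmbedding.exists_append {e : List ℕ → List ℕ} (he : IsTreeEmbedding e)
    (u t : List ℕ) : ∃ u', u'.length = u.length ∧ e (u ++ t) = u' ++ e t := by
  obtain ⟨g, hg, -⟩ := he.cons
  induction u with
  | nil => exact ⟨[], rfl, rfl⟩
  | cons a u ih =>
    obtain ⟨u', h1, h2⟩ := ih
    exact ⟨g (a :: (u ++ t)) :: u', by simp [h1], by rw [List.cons_append, hg, h2]; rfl⟩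

theorem IsTreeEmbedding.exists_descendant {e : List ℕ → List ℕ} (he : IsTreeEmbedding e)
    {u t : List ℕ} (hu : u ≠ []) : ∃ u' ≠ [], e (u ++ t) = u' ++ e t := by
  obtain ⟨u', h1, h2⟩ := he.exists_append u t
  refine ⟨u', ?_, h2⟩
  rintro rfl
  exact hu (List.length_eq_zero_iff.1 h1.symm)

theorem IsTreeEmbedding.nodeLT {e : List ℕ → List ℕ} (he : IsTreeEmbedding e) {l l' : List ℕ}
    (h : NodeLT l l') : NodeLT (e l) (e l') := by
  rcases h with ⟨u, hu, rfl⟩ | ⟨u, v, a, b, t, hab, rfl, rfl⟩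
  · exact Or.inl (he.exists_descendant hu)
  · obtain ⟨u', -, hu'⟩ := he.exists_append u (a :: t)
    obtain ⟨v', -, hv'⟩ := he.exists_append v (b :: t)
    obtain ⟨g, hg, hlt⟩ := he.cons
    rw [hg] at hu' hv'
    exact Or.inr ⟨u', v', _, _, e t, hlt t a b hab, hu', hv'⟩

/-- Ancestors of image nodes are images of ancestors; this is what makes the skeleton closed. -/
theorem IsTreeEmbedding.mem_range_of_append {e : List ℕ → List ℕ} (he : IsTreeEmbedding e)
    {u t l : List ℕ} (h : e l = u ++ t) : ∃ s, s <:+ l ∧ e s = t := by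
  obtain ⟨g, hg, -⟩ := he.cons
  induction l generalizing u with
  | nil =>
    rw [he.nil] at h
    exact ⟨[], List.suffix_rfl, by rw [he.nil, (List.append_eq_nil_iff.1 h.symm).2]⟩
  | cons a l ih =>
    cases u with
    | nil => exact ⟨a :: l, List.suffix_rfl, h⟩
    | cons b u =>
      rw [hg, List.cons_append, List.cons.injEq] at h
      obtain ⟨s, h1, h2⟩ := ih h.2
      exact ⟨s, h1.trans (List.suffix_cons _ _), h2⟩

/-! ### Ordinals as nodes -/

/-- `δ` is cut by the points `ρ 0 = 0 < ρ 1 < ⋯ < ρ M = δ` into `M` pieces, the order types of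
which are powers of `ω`; the exponents are non-increasing. -/
structure IsCut (δ : Ordinal.{0}) (M : ℕ) (ρ : ℕ → Ordinal.{0}) (γ : ℕ → ℕ) : Prop where
  zero : ρ 0 = 0
  succ : ∀ m < M, ρ (m + 1) = ρ m + ω ^ (γ m : Ordinal.{0})
  dvd : ∀ m < M, ω ^ (γ m : Ordinal.{0}) ∣ ρ m
  last : ρ M = δ

/-- The lists that name a point: the first entries are the positions among siblings, the last
entry is the piece. -/
inductive IsNode (M : ℕ) (γ : ℕ → ℕ) : List ℕ → ℕ → Prop
  | root {m : ℕ} : m < M → IsNode M γ [m] (γ m)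
  | child {l : List ℕ} {k : ℕ} (a : ℕ) : IsNode M γ l (k + 1) → IsNode M γ (a :: l) k

/-- The rank of a node. -/
def nodeRank (γ : ℕ → ℕ) : List ℕ → ℕ
  | [] => 0
  | [m] => γ m
  | _ :: b :: l => nodeRank γ (b :: l) - 1

/-- The left end of the interval of descendants of a node. -/
def nodeBase (ρ : ℕ → Ordinal.{0}) (γ : ℕ → ℕ) : List ℕ → Ordinal.{0}
  | [] => 0
  | [m] => ρ m
  | a :: b :: l => nodeBase ρ γ (b :: l) + ω ^ (nodeRank γ (a :: b :: l) : Ordinal.{0}) * a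

/-- The right end of the interval of descendants of a node. -/
def nodeVal (ρ : ℕ → Ordinal.{0}) (γ : ℕ → ℕ) (l : List ℕ) : Ordinal.{0} :=
  nodeBase ρ γ l + ω ^ (nodeRank γ l : Ordinal.{0})

/-- The point named by a node. -/
def nodePt (ρ : ℕ → Ordinal.{0}) (γ : ℕ → ℕ) (l : List ℕ) : Ordinal.{0} :=
  nodeVal ρ γ l - 1

section Nodes

variable {δ : Ordinal.{0}} {M : ℕ} {ρ : ℕ → Ordinal.{0}} {γ : ℕ → ℕ} {l l' u v t : List ℕ} {k : ℕ}

theorem IsNode.ne_nil (h : IsNode M γ l k) : l ≠ [] := by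
  cases h <;> simp

theorem IsNode.nodeRank_eq (h : IsNode M γ l k) : nodeRank γ l = k := by
  induction h with
  | root _ => rfl
  | @child l k a h ih =>
    obtain ⟨b, l, rfl⟩ := List.exists_cons_of_ne_nil h.ne_nil
    rw [nodeRank, ih, Nat.add_sub_cancel]

theorem IsNode.nodeBase_cons (h : IsNode M γ l (k + 1)) (a : ℕ) :
    nodeBase ρ γ (a :: l) = nodeBase ρ γ l + ω ^ (k : Ordinal.{0}) * a := by
  have h1 := (h.child a).nodeRank_eq
  obtain ⟨b, l, rfl⟩ := List.exists_cons_of_ne_nil h.ne_nil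
  rw [nodeBase, h1]

theorem IsNode.nodeVal_eq (h : IsNode M γ l k) :
    nodeVal ρ γ l = nodeBase ρ γ l + ω ^ (k : Ordinal.{0}) := by
  rw [nodeVal, h.nodeRank_eq]

theorem IsNode.dvd (h : IsNode M γ l k) (hc : IsCut δ M ρ γ) :
    ω ^ (k : Ordinal.{0}) ∣ nodeBase ρ γ l := by
  induction h with
  | root hm => exact hc.dvd _ hm
  | @child l k a h ih =>
    rw [h.nodeBase_cons]
    exact omega0_opow_dvd_add_mul (by exact_mod_cast ih) _

theorem one_add_nodePt (ρ : ℕ → Ordinal.{0}) (γ : ℕ → ℕ) (l : List ℕ) :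
    1 + nodePt ρ γ l = nodeVal ρ γ l :=
  Ordinal.add_sub_cancel_of_le
    ((Order.one_le_iff_pos.2 (omega0_opow_pos _)).trans le_add_self)

theorem nodePt_lt_iff : nodePt ρ γ l < nodePt ρ γ l' ↔ nodeVal ρ γ l < nodeVal ρ γ l' := by
  rw [← one_add_nodePt, ← one_add_nodePt, add_lt_add_iff_left]

theorem IsNode.lastTerm (h : IsNode M γ l k) (hc : IsCut δ M ρ γ) :
    LastTerm (nodePt ρ γ l) (nodeBase ρ γ l) k :=
  ⟨h.dvd hc, by rw [one_add_nodePt, h.nodeVal_eq]⟩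

theorem nodeBase_lt_nodeVal (ρ : ℕ → Ordinal.{0}) (γ : ℕ → ℕ) (l : List ℕ) :
    nodeBase ρ γ l < nodeVal ρ γ l :=
  lt_add_of_pos_right _ (omega0_opow_pos _)

theorem IsNode.of_append (h : IsNode M γ (u ++ t) k) (ht : t ≠ []) :
    IsNode M γ t (k + u.length) := by
  induction u generalizing k with
  | nil => exact h
  | cons a u ih =>
    rw [List.cons_append] at h
    generalize hs : u ++ t = s at h ih
    cases h with
    | root _ => simp [ht] at hs
    | child a h =>
      have := ih h
      rwa [List.length_cons, Nat.add_comm u.length, ← Nat.add_assoc]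

theorem IsNode.nodeVal_cons (h : IsNode M γ l (k + 1)) (a : ℕ) :
    nodeVal ρ γ (a :: l) = nodeBase ρ γ l + ω ^ (k : Ordinal.{0}) * ((a + 1 : ℕ) : Ordinal.{0}) := by
  rw [(h.child a).nodeVal_eq, h.nodeBase_cons, add_assoc, ← mul_add_one, Nat.cast_succ]

theorem IsNode.nodeVal_cons_lt (h : IsNode M γ l (k + 1)) (a : ℕ) :
    nodeVal ρ γ (a :: l) < nodeVal ρ γ l := by
  rw [h.nodeVal_cons, h.nodeVal_eq, add_lt_add_iff_left, Nat.cast_succ k]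
  exact omega0_opow_mul_nat_lt_succ _ _

theorem IsNode.nodeBase_le_append (h : IsNode M γ (u ++ t) k) (ht : t ≠ []) :
    nodeBase ρ γ t ≤ nodeBase ρ γ (u ++ t) := by
  induction u generalizing k with
  | nil => exact le_rfl
  | cons a u ih =>
    have h1 : IsNode M γ (u ++ t) (k + 1) := IsNode.of_append (u := [a]) h (by simp [ht])
    rw [List.cons_append, h1.nodeBase_cons]
    exact (ih h1).trans le_self_add

theorem IsNode.nodeVal_append_le (h : IsNode M γ (u ++ t) k) (ht : t ≠ []) :
    nodeVal ρ γ (u ++ t) ≤ nodeVal ρ γ t := by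
  induction u generalizing k with
  | nil => exact le_rfl
  | cons a u ih =>
    have h1 : IsNode M γ (u ++ t) (k + 1) := IsNode.of_append (u := [a]) h (by simp [ht])
    exact (h1.nodeVal_cons_lt a).le.trans (ih h1)

theorem IsNode.nodeVal_append_lt (h : IsNode M γ (u ++ t) k) (ht : t ≠ []) (hu : u ≠ []) :
    nodeVal ρ γ (u ++ t) < nodeVal ρ γ t := by
  obtain ⟨a, u, rfl⟩ := List.exists_cons_of_ne_nil hu
  have h1 : IsNode M γ (u ++ t) (k + 1) := IsNode.of_append (u := [a]) h (by simp [ht])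
  exact (h1.nodeVal_cons_lt a).trans_le (h1.nodeVal_append_le ht)

theorem IsCut.mono (hc : IsCut δ M ρ γ) {m m' : ℕ} (h : m ≤ m') (hM : m' ≤ M) : ρ m ≤ ρ m' := by
  induction m', h using Nat.le_induction with
  | base => exact le_rfl
  | succ i _ ih =>
    rw [hc.succ i hM]
    exact (ih (by omega)).trans le_self_add

theorem IsCut.nodeVal_singleton (hc : IsCut δ M ρ γ) {m : ℕ} (hm : m < M) :
    nodeVal ρ γ [m] = ρ (m + 1) :=
  (hc.succ m hm).symm

theorem IsNode.lt_of_singleton {m : ℕ} (h : IsNode M γ [m] k) : m < M := by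
  cases h with
  | root hm => exact hm
  | child _ h => exact absurd rfl h.ne_nil

/-- Intervals of different branches are disjoint and ordered as the entries at which the branches
split. With the nesting of intervals along a branch, this matches the post-order with the order of
ordinals. -/
theorem IsCut.nodeVal_le_nodeBase (hc : IsCut δ M ρ γ) {a b k' : ℕ}
    (h : IsNode M γ (u ++ a :: t) k) (h' : IsNode M γ (v ++ b :: t) k') (hab : a < b) :
    nodeVal ρ γ (u ++ a :: t) ≤ nodeBase ρ γ (v ++ b :: t) := by
  refine (h.nodeVal_append_le (by simp)).trans (le_trans ?_ (h'.nodeBase_le_append (by simp)))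
  have h1 := h.of_append (List.cons_ne_nil a t)
  have h2 := h'.of_append (List.cons_ne_nil b t)
  rcases eq_or_ne t [] with rfl | ht
  · rw [hc.nodeVal_singleton h1.lt_of_singleton]
    exact hc.mono hab h2.lt_of_singleton.le
  · have h3 := IsNode.of_append (u := [a]) h1 ht
    have h4 := IsNode.of_append (u := [b]) h2 ht
    rw [← show k + u.length = k' + v.length by
      simpa using h3.nodeRank_eq.symm.trans h4.nodeRank_eq] at h4
    rw [IsNode.nodeVal_cons h3, IsNode.nodeBase_cons h4]
    gcongr
    exact hab

theorem IsCut.nodeVal_lt (hc : IsCut δ M ρ γ) {k' : ℕ} (h : IsNode M γ l k)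
    (h' : IsNode M γ l' k') (hlt : NodeLT l l') : nodeVal ρ γ l < nodeVal ρ γ l' := by
  rcases hlt with ⟨u, hu, rfl⟩ | ⟨u, v, a, b, t, hab, rfl, rfl⟩
  · exact h.nodeVal_append_lt h'.ne_nil hu
  · exact (hc.nodeVal_le_nodeBase h h' hab).trans_lt (nodeBase_lt_nodeVal _ _ _)

theorem IsCut.nodeLT_of_nodeVal_lt (hc : IsCut δ M ρ γ) {k' : ℕ} (h : IsNode M γ l k)
    (h' : IsNode M γ l' k') (hlt : nodeVal ρ γ l < nodeVal ρ γ l') : NodeLT l l' := by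
  rcases nodeLT_trichotomy l l' with rfl | h1 | h1
  · exact absurd hlt (lt_irrefl _)
  · exact h1
  · exact absurd hlt (hc.nodeVal_lt h' h h1).not_gt

theorem IsCut.eq_of_nodeVal_eq (hc : IsCut δ M ρ γ) {k' : ℕ} (h : IsNode M γ l k)
    (h' : IsNode M γ l' k') (heq : nodeVal ρ γ l = nodeVal ρ γ l') : l = l' := by
  rcases nodeLT_trichotomy l l' with rfl | h1 | h1
  · rfl
  · exact absurd heq (hc.nodeVal_lt h h' h1).ne
  · exact absurd heq (hc.nodeVal_lt h' h h1).ne'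

/-- The points in the interval of a node are named by its descendants. -/
theorem IsCut.exists_append_of_mem (hc : IsCut δ M ρ γ) {k' : ℕ} (h : IsNode M γ l k)
    (h' : IsNode M γ l' k') (h1 : nodeBase ρ γ l' < nodeVal ρ γ l)
    (h2 : nodeVal ρ γ l ≤ nodeVal ρ γ l') : ∃ u, l = u ++ l' := by
  rcases nodeLT_trichotomy l l' with rfl | h3 | h3
  · exact ⟨[], rfl⟩
  · rcases h3 with ⟨u, -, rfl⟩ | ⟨u, v, a, b, t, hab, rfl, rfl⟩
    · exact ⟨u, rfl⟩
    · exact absurd h1 (hc.nodeVal_le_nodeBase h h' hab).not_gt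
  · exact absurd h2 (hc.nodeVal_lt h' h h3).not_ge

/-- Descend into the child whose interval contains `ξ`, unless `ξ` is already the right end; at rank
`0` the interval has a single point. -/
theorem IsNode.exists_of_mem (h : IsNode M γ l k) {ξ : Ordinal.{0}} (h1 : nodeBase ρ γ l < ξ)
    (h2 : ξ ≤ nodeVal ρ γ l) : ∃ l' k', IsNode M γ l' k' ∧ nodeVal ρ γ l' = ξ := by
  induction k generalizing l with
  | zero =>
    refine ⟨l, 0, h, (h2.antisymm ?_).symm⟩
    rw [h.nodeVal_eq, Nat.cast_zero, opow_zero]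
    exact Order.add_one_le_of_lt h1
  | succ k ih =>
    rcases h2.eq_or_lt with rfl | h3
    · exact ⟨l, k + 1, h, rfl⟩
    · rw [h.nodeVal_eq, Nat.cast_succ] at h3
      obtain ⟨a, h4, h5⟩ := exists_natCast_of_lt_opow_succ h1 h3
      refine ih (h.child a) ?_ ?_
      · rwa [h.nodeBase_cons]
      · rwa [(h.child a).nodeVal_eq, h.nodeBase_cons]

theorem IsCut.exists_piece (hc : IsCut δ M ρ γ) {ξ : Ordinal.{0}} (h0 : 0 < ξ) (h : ξ ≤ δ) :
    ∃ m < M, ρ m < ξ ∧ ξ ≤ ρ (m + 1) := by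
  classical
  have hex : ∃ i, ξ ≤ ρ i := ⟨M, hc.last ▸ h⟩
  obtain ⟨m, hm⟩ := Nat.exists_eq_succ_of_ne_zero (n := Nat.find hex) fun h1 => by
    have := Nat.find_spec hex
    rw [h1, hc.zero] at this
    exact this.not_gt h0
  have hM : Nat.find hex ≤ M := Nat.find_min' hex (hc.last ▸ h)
  exact ⟨m, by omega, not_le.1 (Nat.find_min hex (by omega)), by
    have := Nat.find_spec hex
    rwa [hm] at this⟩

theorem IsCut.exists_node (hc : IsCut δ M ρ γ) {ξ : Ordinal.{0}} (h0 : 0 < ξ) (h : ξ ≤ δ) :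
    ∃ l k, IsNode M γ l k ∧ nodeVal ρ γ l = ξ := by
  obtain ⟨m, hm, h1, h2⟩ := hc.exists_piece h0 h
  exact (IsNode.root hm).exists_of_mem h1 (by rwa [hc.nodeVal_singleton hm])

theorem IsNode.map (h : IsNode M γ l k) {e : List ℕ → List ℕ} (he : IsTreeEmbedding e) :
    IsNode M γ (e l) k := by
  obtain ⟨g, hg, -⟩ := he.cons
  induction h with
  | root hm => rw [he.singleton]; exact .root hm
  | child a h ih => rw [hg]; exact .child _ ih

theorem IsNode.exists_root (h : IsNode M γ l k) :
    ∃ s m, m < M ∧ l = s ++ [m] ∧ s.length + k = γ m := by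
  induction h with
  | @root m hm => exact ⟨[], m, hm, rfl, by simp⟩
  | child a h ih =>
    obtain ⟨s, m, hm, rfl, hs⟩ := ih
    exact ⟨a :: s, m, hm, rfl, by rw [List.length_cons]; omega⟩

end Nodes

/-! ### The skeleton given by a tree embedding -/

theorem not_nodeLT_self (l : List ℕ) : ¬ NodeLT l l := by
  rintro (⟨u, hu, h⟩ | ⟨u, v, a, b, t, hab, h1, h2⟩)
  · exact hu (List.self_eq_append_left.1 h)
  · have := (List.append_inj' (h1.symm.trans h2) rfl).2
    exact hab.ne (List.cons.inj this).1

theorem IsTreeEmbedding.injective {e : List ℕ → List ℕ} (he : IsTreeEmbedding e) :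
    Function.Injective e := by
  intro l l' h
  rcases nodeLT_trichotomy l l' with h1 | h1 | h1
  · exact h1
  · exact absurd (h ▸ he.nodeLT h1) (not_nodeLT_self _)
  · exact absurd (h ▸ he.nodeLT h1) (not_nodeLT_self _)

theorem IsTreeEmbedding.descendant_iff {e : List ℕ → List ℕ} (he : IsTreeEmbedding e)
    {l l' : List ℕ} : (∃ u ≠ [], e l = u ++ e l') ↔ ∃ u ≠ [], l = u ++ l' := by
  constructor
  · rintro ⟨u, hu, h⟩
    obtain ⟨s, ⟨w, rfl⟩, h2⟩ := he.mem_range_of_append h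
    rw [he.injective h2] at h ⊢
    refine ⟨w, ?_, rfl⟩
    rintro rfl
    exact hu (List.self_eq_append_left.1 h)
  · rintro ⟨u, hu, rfl⟩
    exact he.exists_descendant hu

theorem isOpen_setOf_lt_one_add (b : Ordinal.{0}) : IsOpen {y : Ordinal.{0} | b < 1 + y} := by
  rcases eq_zero_or_pos b with rfl | hb
  · have : {y : Ordinal.{0} | 0 < 1 + y} = Set.univ := by
      ext y
      exact iff_of_true (zero_lt_one.trans_le le_self_add : (0 : Ordinal.{0}) < 1 + y) (mem_univ y)
    rw [this]
    exact isOpen_univ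
  · obtain ⟨b', rfl⟩ := exists_one_add_eq hb
    have : {y : Ordinal.{0} | 1 + b' < 1 + y} = Ioi b' :=
      by
      ext y
      rw [mem_ofPred_eq, add_lt_add_iff_left, mem_Ioi]
    rw [this]
    exact isOpen_Ioi

section Skeleton

variable {δ : Ordinal.{0}} {M : ℕ} {ρ : ℕ → Ordinal.{0}} {γ : ℕ → ℕ} {l l' : List ℕ} {k k' : ℕ}
  {e : List ℕ → List ℕ}

/-- The map of ordinals induced by a map of nodes. -/
def treeMap (M : ℕ) (ρ : ℕ → Ordinal.{0}) (γ : ℕ → ℕ) (e : List ℕ → List ℕ) (β : Ordinal.{0}) :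
    Ordinal.{0} :=
  nodePt ρ γ (e (Classical.epsilon fun l => (∃ k, IsNode M γ l k) ∧ nodePt ρ γ l = β))

theorem IsCut.eq_of_nodePt_eq (hc : IsCut δ M ρ γ) (h : IsNode M γ l k) (h' : IsNode M γ l' k')
    (heq : nodePt ρ γ l = nodePt ρ γ l') : l = l' :=
  hc.eq_of_nodeVal_eq h h' (by rw [← one_add_nodePt, ← one_add_nodePt, heq])

theorem IsCut.treeMap_nodePt (hc : IsCut δ M ρ γ) (h : IsNode M γ l k) (e : List ℕ → List ℕ) :
    treeMap M ρ γ e (nodePt ρ γ l) = nodePt ρ γ (e l) := by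
  obtain ⟨⟨k', h1⟩, h2⟩ := Classical.epsilon_spec
    (p := fun l' => (∃ k, IsNode M γ l' k) ∧ nodePt ρ γ l' = nodePt ρ γ l) ⟨l, ⟨k, h⟩, rfl⟩
  rw [treeMap, hc.eq_of_nodePt_eq h1 h h2]

theorem IsCut.exists_nodePt (hc : IsCut δ M ρ γ) (hω : ω ≤ δ) {β : Ordinal.{0}} (hβ : β < δ) :
    ∃ l k, IsNode M γ l k ∧ nodePt ρ γ l = β := by
  obtain ⟨l, k, h1, h2⟩ := hc.exists_node (ξ := 1 + β) (zero_lt_one.trans_le le_self_add)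
    (((add_lt_add_iff_left 1).2 hβ).le.trans (one_add_of_omega0_le hω).le)
  exact ⟨l, k, h1, by rw [← add_right_inj (1 : Ordinal.{0}), one_add_nodePt, h2]⟩

theorem IsCut.ne_zero (hc : IsCut δ M ρ γ) (hω : ω ≤ δ) : M ≠ 0 := by
  rintro rfl
  rw [← hc.last, hc.zero] at hω
  exact hω.not_gt omega0_pos

/-- As `1 + δ = δ`, the last root names `δ` itself. Tree embeddings fix it, so they act on the
remaining nodes. -/
theorem IsCut.nodePt_lt (hc : IsCut δ M ρ γ) (hω : ω ≤ δ) (h : IsNode M γ l k) :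
    nodePt ρ γ l < δ ↔ l ≠ [M - 1] := by
  have hM := hc.ne_zero hω
  have hroot : nodeVal ρ γ [M - 1] = δ := by
    rw [hc.nodeVal_singleton (by omega), Nat.sub_add_cancel (by omega), hc.last]
  rw [← add_lt_add_iff_left 1, one_add_nodePt, one_add_of_omega0_le hω]
  constructor
  · rintro h1 rfl
    exact h1.ne hroot
  · intro h1
    refine lt_of_le_of_ne ?_ fun h2 => h1 (hc.eq_of_nodeVal_eq h (.root (by omega))
      (h2.trans hroot.symm))
    obtain ⟨s, m, hm, rfl, -⟩ := h.exists_root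
    refine (h.nodeVal_append_le (by simp)).trans ?_
    rw [hc.nodeVal_singleton hm, ← hc.last]
    exact hc.mono hm le_rfl

theorem IsCut.nodePt_map_lt_iff (hc : IsCut δ M ρ γ) (hω : ω ≤ δ) (h : IsNode M γ l k)
    (he : IsTreeEmbedding e) : nodePt ρ γ (e l) < δ ↔ nodePt ρ γ l < δ := by
  rw [hc.nodePt_lt hω h, hc.nodePt_lt hω (h.map he), ← he.singleton, he.injective.ne_iff,
    he.singleton]

theorem IsCut.treeMap_lt (hc : IsCut δ M ρ γ) (hω : ω ≤ δ) (he : IsTreeEmbedding e)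
    {β : Ordinal.{0}} (hβ : β < δ) : treeMap M ρ γ e β < δ := by
  obtain ⟨l, k, h, rfl⟩ := hc.exists_nodePt hω hβ
  rwa [hc.treeMap_nodePt h, hc.nodePt_map_lt_iff hω h he]

theorem IsCut.strictMonoOn_treeMap (hc : IsCut δ M ρ γ) (hω : ω ≤ δ) (he : IsTreeEmbedding e) :
    StrictMonoOn (treeMap M ρ γ e) (Iio δ) := by
  intro α hα β hβ hαβ
  obtain ⟨l, k, h, rfl⟩ := hc.exists_nodePt hω hα
  obtain ⟨l', k', h', rfl⟩ := hc.exists_nodePt hω hβ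
  rw [hc.treeMap_nodePt h, hc.treeMap_nodePt h', nodePt_lt_iff]
  exact hc.nodeVal_lt (h.map he) (h'.map he)
    (he.nodeLT (hc.nodeLT_of_nodeVal_lt h h' (nodePt_lt_iff.1 hαβ)))

theorem IsCut.treeLT_nodePt_iff (hc : IsCut δ M ρ γ) (h : IsNode M γ l k)
    (h' : IsNode M γ l' k') :
    TreeLT (nodePt ρ γ l) (nodePt ρ γ l') ↔ ∃ u ≠ [], l = u ++ l' := by
  rw [(h'.lastTerm hc).treeLT_iff, one_add_nodePt, nodePt_lt_iff]
  constructor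
  · rintro ⟨h1, h2⟩
    obtain ⟨u, rfl⟩ := hc.exists_append_of_mem h h' h1 h2.le
    exact ⟨u, by rintro rfl; exact h2.ne rfl, rfl⟩
  · rintro ⟨u, hu, rfl⟩
    exact ⟨(h.nodeBase_le_append h'.ne_nil).trans_lt (nodeBase_lt_nodeVal _ _ _),
      h.nodeVal_append_lt h'.ne_nil hu⟩

theorem IsCut.treeLT_treeMap_iff (hc : IsCut δ M ρ γ) (hω : ω ≤ δ) (he : IsTreeEmbedding e)
    {α β : Ordinal.{0}} (hα : α < δ) (hβ : β < δ) :
    TreeLT (treeMap M ρ γ e α) (treeMap M ρ γ e β) ↔ TreeLT α β := by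
  obtain ⟨l, k, h, rfl⟩ := hc.exists_nodePt hω hα
  obtain ⟨l', k', h', rfl⟩ := hc.exists_nodePt hω hβ
  rw [hc.treeMap_nodePt h, hc.treeMap_nodePt h', hc.treeLT_nodePt_iff h h',
    hc.treeLT_nodePt_iff (h.map he) (h'.map he), he.descendant_iff]

theorem IsCut.isClosed_image_treeMap (hc : IsCut δ M ρ γ) (hω : ω ≤ δ)
    (he : IsTreeEmbedding e) :
    IsClosed {x : Iio δ | (x : Ordinal.{0}) ∈ treeMap M ρ γ e '' Iio δ} := by
  rw [← isOpen_compl_iff, isOpen_iff_mem_nhds]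
  rintro ⟨x, hx⟩ hxI
  obtain ⟨l, k, h, rfl⟩ := hc.exists_nodePt hω hx
  -- This neighbourhood of a point outside the image is its subtree. An image node in it would put
  -- its ancestor `l` in the range of `e`.
  have hopen : IsOpen ((↑) ⁻¹' ({y : Ordinal.{0} | nodeBase ρ γ l < 1 + y} ∩
      Iio (nodePt ρ γ l + 1)) : Set (Iio δ)) :=
    ((isOpen_setOf_lt_one_add _).inter isOpen_Iio).preimage continuous_subtype_val
  refine Filter.mem_of_superset (hopen.mem_nhds ⟨(h.lastTerm hc).pos,
    mem_Iio.2 (Order.lt_add_one_iff.2 le_rfl)⟩) ?_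
  rintro ⟨_, hy⟩ ⟨hy1, hy2⟩ ⟨z, hz, rfl⟩
  refine hxI ?_
  obtain ⟨s, j, hs, rfl⟩ := hc.exists_nodePt hω hz
  have hy1' : nodeBase ρ γ l < 1 + treeMap M ρ γ e (nodePt ρ γ s) := hy1
  have hy2' : treeMap M ρ γ e (nodePt ρ γ s) ≤ nodePt ρ γ l := Order.lt_add_one_iff.1 hy2
  rw [hc.treeMap_nodePt hs] at hy1' hy2'
  rw [one_add_nodePt] at hy1'
  rw [← add_le_add_iff_left 1, one_add_nodePt, one_add_nodePt] at hy2'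
  obtain ⟨u, hu⟩ := hc.exists_append_of_mem (hs.map he) h hy1' hy2'
  obtain ⟨t, ⟨w, rfl⟩, rfl⟩ := he.mem_range_of_append hu
  have ht : t ≠ [] := by
    rintro rfl
    exact h.ne_nil he.nil
  have ht' := hs.of_append ht
  exact ⟨nodePt ρ γ t, (hc.nodePt_map_lt_iff hω ht' he).1 hx, hc.treeMap_nodePt ht' e⟩

theorem IsCut.isSkeleton (hc : IsCut δ M ρ γ) (hω : ω ≤ δ) (he : IsTreeEmbedding e) :
    IsSkeleton δ (treeMap M ρ γ e '' Iio δ) where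
  subset := by
    rintro _ ⟨β, hβ, rfl⟩
    exact hc.treeMap_lt hω he hβ
  closed := hc.isClosed_image_treeMap hω he
  otp_eq := otp_image (hc.strictMonoOn_treeMap hω he)
  treeLT_iff := by
    rintro _ ⟨α, hα, rfl⟩ _ ⟨β, hβ, rfl⟩
    rw [collapse_image (hc.strictMonoOn_treeMap hω he) hα,
      collapse_image (hc.strictMonoOn_treeMap hω he) hβ, hc.treeLT_treeMap_iff hω he hα hβ]

end Skeleton

theorem transport_image {f : Ordinal.{0} → Ordinal.{0}} {δ : Ordinal.{0}}
    (hf : StrictMonoOn f (Iio δ)) {n : ℕ} (col : Sym2 Ordinal.{0} → Fin n) {α β : Ordinal.{0}}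
    (hα : α < δ) (hβ : β < δ) : transport (f '' Iio δ) col s(α, β) = col s(f α, f β) := by
  have h : ∀ α < δ, Function.invFunOn (collapse (f '' Iio δ)) (f '' Iio δ) α = f α := by
    intro α hα
    have h1 : ∃ x ∈ f '' Iio δ, collapse (f '' Iio δ) x = α :=
      ⟨f α, ⟨α, hα, rfl⟩, collapse_image hf hα⟩
    obtain ⟨β, hβ, h2⟩ := Function.invFunOn_mem h1
    have h3 := Function.invFunOn_eq h1
    rw [← h2, collapse_image hf hβ] at h3
    rw [← h2, h3]
  rw [transport, Sym2.map_mk, h α hα, h β hβ]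

/-! ### Large sets of nodes -/

section Large

variable {δ : Ordinal.{0}} {M : ℕ} {ρ : ℕ → Ordinal.{0}} {γ : ℕ → ℕ} {θ : List ℕ} {k : ℕ}

/-- Translating by the base of `θ` turns the core of `ω ^ k` into descendants of `θ`. Position `a`
in a fan has place `a + 1`, so place greater than `r` means `r ≤ a`. -/
theorem FanCore.exists_node (hθ : IsNode M γ θ k) (hk : 0 < k) {r : ℕ}
    {x ξ : Ordinal.{0}} (h : FanCore r k x ξ) :
    ∃ (u : List ℕ) (n : ℕ) (b : Ordinal.{0}), x = n ∧ IsNode M γ (u ++ θ) n ∧ (∀ a ∈ u, r ≤ a) ∧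
      u.length + n = k ∧ LastTerm ξ b n ∧ nodeBase ρ γ θ + b = nodeBase ρ γ (u ++ θ) := by
  induction h with
  | top =>
    refine ⟨[], k, 0, rfl, hθ, by simp, by simp, ⟨dvd_zero _, ?_⟩, by simp⟩
    rw [zero_add]
    refine one_add_of_omega0_le ?_
    conv_lhs => rw [← opow_one ω]
    exact opow_le_opow_right omega0_pos (by exact_mod_cast hk)
  | @step n β ξ _ hcov hplace ih =>
    obtain ⟨u, N, b, hN, hnode, hu, hlen, hβ, hb⟩ := ih
    obtain ⟨N, rfl⟩ := Nat.exists_eq_succ_of_ne_zero (n := N) (by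
      rintro rfl
      rw [Nat.cast_zero] at hN
      exact Order.succ_ne_bot n hN)
    rw [Nat.cast_succ] at hN hβ
    obtain rfl : n = N := Order.succ_injective hN
    obtain ⟨a, ha⟩ := exists_of_treeCov hβ hcov
    rw [placeInFan_eq hβ.dvd ha, Nat.cast_lt] at hplace
    refine ⟨a :: u, N, b + ω ^ (N : Ordinal.{0}) * a, rfl, hnode.child a, ?_, ?_,
      ⟨omega0_opow_dvd_add_mul hβ.dvd _, ha⟩, ?_⟩
    · intro c hca
      rcases List.mem_cons.1 hca with rfl | hca
      · omega
      · exact hu c hca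
    · rw [List.length_cons]; omega
    · rw [List.cons_append, hnode.nodeBase_cons, ← hb, add_assoc]

theorem IsCut.exists_of_mem_fanCore (hc : IsCut δ M ρ γ) (hθ : IsNode M γ θ k) {n r : ℕ}
    (hn : n < k) {β : Ordinal.{0}} (hβ : β ∈ fanCore (nodePt ρ γ θ) r n) :
    ∃ u ≠ [], IsNode M γ (u ++ θ) n ∧ (∀ a ∈ u, r ≤ a) ∧ u.length + n = k ∧
      β = nodePt ρ γ (u ++ θ) := by
  obtain ⟨h1, h2⟩ := hβ
  rw [(hθ.lastTerm hc).cbRank] at h2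
  obtain ⟨u, n', b, h3, h4, h5, h6, h7, h8⟩ := h2.exists_node (ρ := ρ) hθ (by omega)
  obtain rfl : n = n' := by exact_mod_cast h3
  refine ⟨u, by rintro rfl; simp at h6; omega, h4, h5, h6, ?_⟩
  rw [← add_right_inj (1 : Ordinal.{0}), one_add_nodePt, ← (hθ.lastTerm hc).add_collapse h1,
    h7.eq, ← add_assoc, h8, h4.nodeVal_eq]

theorem IsCut.isLargeAt (hc : IsCut δ M ρ γ) (hθ : IsNode M γ θ k) {n r : ℕ} (hn : n < k)
    {C : Type*} {f : Ordinal.{0} → C} {c : C}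
    (h : ∀ u ≠ [], IsNode M γ (u ++ θ) n → (∀ a ∈ u, r ≤ a) → u.length + n = k →
      f (nodePt ρ γ (u ++ θ)) = c) :
    IsLargeAt (nodePt ρ γ θ) r n {β ∈ subtreeLevel (nodePt ρ γ θ) n | f β = c} := by
  refine ⟨fun β hβ => hβ.1, fun β hβ => ?_⟩
  obtain ⟨u, hu, h1, h2, h3, rfl⟩ := hc.exists_of_mem_fanCore hθ hn hβ
  exact ⟨⟨(hc.treeLT_nodePt_iff h1 hθ).2 ⟨u, hu, rfl⟩, (h1.lastTerm hc).cbRank⟩, h u hu h1 h2 h3⟩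

end Large

/-! ### Components -/

section Components

variable {δ : Ordinal.{0}} {M : ℕ} {ρ : ℕ → Ordinal.{0}} {γ : ℕ → ℕ}

/-- If the first piece were finite, divisibility would force every later piece to be finite.
Consequently `1 + ρ m = ρ m` for `m ≥ 1`, and components can be read off in the shifted coordinate.
-/
theorem IsCut.omega0_le (hc : IsCut δ M ρ γ) (hω : ω ≤ δ) {m : ℕ} (hm : 1 ≤ m) (hM : m ≤ M) :
    ω ≤ ρ m := by
  refine le_trans ?_ (hc.mono hm hM)
  by_contra! h1
  have h0 : 0 < ρ 1 := by
    rw [hc.succ 0 (by omega)]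
    exact (omega0_opow_pos _).trans_le le_add_self
  have h2 : ∀ i, 1 ≤ i → i ≤ M → ρ i < ω := by
    intro i hi
    induction i, hi using Nat.le_induction with
    | base => exact fun _ => h1
    | succ i hi ih =>
      intro hiM
      have h3 := ih (by omega)
      rw [hc.succ i hiM]
      exact isPrincipal_add_omega0 h3
        ((le_of_dvd (h0.trans_le (hc.mono hi (by omega))).ne' (hc.dvd i hiM)).trans_lt h3)
  exact hω.not_gt (hc.last ▸ h2 M (by omega) le_rfl)

theorem IsCut.componentIndex_eq (hc : IsCut δ M ρ γ) (hω : ω ≤ δ) (hρ : ∀ i, ρ i = cnfSum δ i)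
    {β : Ordinal.{0}} {m : ℕ} (hm : m < M) (h1 : ρ m < 1 + β) (h2 : 1 + β ≤ ρ (m + 1)) :
    componentIndex δ β = m + 1 := by
  rw [componentIndex]
  refine (IsLeast.csInf_eq ⟨⟨by omega, ?_⟩, ?_⟩)
  · rw [← hρ]
    exact le_add_self.trans h2
  · rintro i ⟨hi1, hi2⟩
    by_contra! hlt
    rw [← hρ] at hi2
    have h3 : 1 + β ≤ ρ i := by
      rw [← one_add_of_omega0_le (hc.omega0_le hω hi1 (by omega))]
      exact (add_le_add_iff_left 1).2 hi2
    exact (h3.trans (hc.mono (by omega) hm.le)).not_gt h1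

theorem IsCut.componentIndex_nodePt (hc : IsCut δ M ρ γ) (hω : ω ≤ δ)
    (hρ : ∀ i, ρ i = cnfSum δ i) {s : List ℕ} {m k : ℕ} (hm : m < M)
    (h : IsNode M γ (s ++ [m]) k) : componentIndex δ (nodePt ρ γ (s ++ [m])) = m + 1 := by
  refine hc.componentIndex_eq hω hρ hm ?_ ?_
  · rw [one_add_nodePt]
    exact (h.nodeBase_le_append (by simp)).trans_lt (nodeBase_lt_nodeVal _ _ _)
  · rw [one_add_nodePt, ← hc.nodeVal_singleton hm]
    exact h.nodeVal_append_le (by simp)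

/-- A component other than the last contains its right end; the last one approaches `δ` as a limit.
The exception, an empty last component with exponent `0`, has supremum `0` and is excluded by `hl`.
-/
theorem IsCut.sSup_component (hc : IsCut δ M ρ γ) (hω : ω ≤ δ) (hρ : ∀ i, ρ i = cnfSum δ i)
    {m : ℕ} (hm : m < M) {l : Ordinal.{0}} (hl : l < cbRank (sSup (component δ (m + 1)))) :
    sSup (component δ (m + 1)) = ρ (m + 1) := by
  have hle : ∀ β ∈ component δ (m + 1), β ≤ ρ (m + 1) := by
    rintro β ⟨hβ, hβm⟩
    obtain ⟨m', hm', h1, h2⟩ := hc.exists_piece (ξ := 1 + β) (zero_lt_one.trans_le le_self_add)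
      (((add_lt_add_iff_left 1).2 hβ).le.trans (one_add_of_omega0_le hω).le)
    rw [hc.componentIndex_eq hω hρ hm' h1 h2] at hβm
    rw [← hβm]
    exact le_add_self.trans h2
  have hω' := hc.omega0_le hω (m := m + 1) (by omega) (by omega)
  have hδ : ρ (m + 1) ≤ δ := hc.last ▸ hc.mono hm le_rfl
  have hlt : ρ m < ρ (m + 1) := by
    rw [hc.succ m hm]
    exact lt_add_of_pos_right _ (omega0_opow_pos _)
  rcases hδ.eq_or_lt with heq | hltδ
  · refine le_antisymm (csSup_le' hle) ?_
    by_contra! hs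
    have hγ : γ m ≠ 0 := by
      intro h0
      have hempty : component δ (m + 1) = ∅ := by
        refine eq_empty_of_forall_notMem ?_
        rintro β ⟨hβ, hβm⟩
        obtain ⟨m', hm', h1, h2⟩ := hc.exists_piece (ξ := 1 + β)
          (zero_lt_one.trans_le le_self_add)
          (((add_lt_add_iff_left 1).2 hβ).le.trans (one_add_of_omega0_le hω).le)
        rw [hc.componentIndex_eq hω hρ hm' h1 h2] at hβm
        obtain rfl : m' = m := by omega
        rw [← add_lt_add_iff_left 1, one_add_of_omega0_le hω, ← heq, hc.succ m' hm, h0,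
          Nat.cast_zero, opow_zero] at hβ
        exact (Order.lt_add_one_iff.1 hβ).not_gt h1
      rw [hempty, csSup_empty, Ordinal.bot_eq_zero, ← Nat.cast_zero, cbRank_natCast] at hl
      exact not_lt_zero hl
    have hlim : Order.IsSuccPrelimit (ρ (m + 1)) := by
      have h1 : (ω : Ordinal.{0}) ∣ ω ^ (γ m : Ordinal.{0}) := by
        conv_lhs => rw [← opow_one ω]
        exact opow_dvd_opow ω (by exact_mod_cast Nat.one_le_iff_ne_zero.2 hγ)
      rw [isSuccPrelimit_iff_omega0_dvd, hc.succ m hm]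
      exact (dvd_add_iff (h1.trans (hc.dvd m hm))).2 h1
    -- Were the supremum too small, the successor of `x` would still lie in the component and exceed
    -- it.
    set x := max (sSup (component δ (m + 1))) (ρ m) with hx
    have hxlt : Order.succ x < ρ (m + 1) := hlim.succ_lt (max_lt hs hlt)
    have hmem : Order.succ x ∈ component δ (m + 1) := by
      refine ⟨hxlt.trans_le hδ, hc.componentIndex_eq hω hρ hm ?_ ?_⟩
      · exact (le_max_right _ _).trans_lt ((Order.lt_succ x).trans_le le_add_self)
      · rw [← one_add_of_omega0_le hω']
        exact (add_le_add_iff_left 1).2 hxlt.le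
    exact ((le_max_left _ _).trans_lt (Order.lt_succ x)).not_ge (le_csSup ⟨_, hle⟩ hmem)
  · refine IsGreatest.csSup_eq ⟨⟨hltδ, hc.componentIndex_eq hω hρ hm ?_ ?_⟩, hle⟩
    · exact hlt.trans_le le_add_self
    · exact (one_add_of_omega0_le hω').le

/-! ### Canonical skeletons of infinite ordinals -/

theorem IsCut.exists_canonicalSkeleton (hc : IsCut δ M ρ γ) (hω : ω ≤ δ)
    (hρ : ∀ i, ρ i = cnfSum δ i) (hM : numComponents δ = M) {n : ℕ} (hn : 0 < n)
    (col : Sym2 Ordinal.{0} → Fin n) : ∃ I, IsCanonicalSkeleton δ col I := by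
  have : Nonempty (Fin n) := ⟨⟨0, hn⟩⟩
  let χ : List ℕ → List ℕ → Fin n := fun l l' => col s(nodePt ρ γ l, nodePt ρ γ l')
  -- Bounds the exponents of all pieces, hence the depth of every node below its root.
  let K := (Finset.range M).sup γ
  have hK : ∀ m < M, γ m ≤ K := fun m hm => Finset.le_sup (Finset.mem_range.2 hm)
  obtain ⟨e, he, c, D, E, hG, hN, hE⟩ := exists_canonical_embedding χ K M
  have hmono := hc.strictMonoOn_treeMap hω he
  let toNat : Ordinal.{0} → ℕ := fun κ => Cardinal.toNat κ.card
  have hnat : ∀ i : ℕ, toNat i = i := fun i => by simp [toNat]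
  have htr : ∀ {l l' : List ℕ} {k k' : ℕ}, IsNode M γ l k → IsNode M γ l' k' →
      nodePt ρ γ l < δ → nodePt ρ γ l' < δ →
      transport (treeMap M ρ γ e '' Iio δ) col s(nodePt ρ γ l, nodePt ρ γ l') =
        χ (e l) (e l') := by
    intro l l' k k' h h' hl hl'
    rw [transport_image hmono col hl hl', hc.treeMap_nodePt h, hc.treeMap_nodePt h']
  have hlarge : ∀ {l : List ℕ} {k : ℕ}, IsNode M γ l k → nodePt ρ γ l < δ →
      ∃ r : ℕ, ∀ θ j, IsNode M γ θ j → nodePt ρ γ θ ≤ δ → ∀ i < j, ∀ u ≠ [],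
        IsNode M γ (u ++ θ) i → (∀ a ∈ u, r ≤ a) → u.length + i = j →
        transport (treeMap M ρ γ e '' Iio δ) col
          s(nodePt ρ γ l, nodePt ρ γ (u ++ θ)) = c l θ (j - i) := by
    intro l k h hl
    obtain ⟨r, hr⟩ := hG l
    refine ⟨r, fun θ j hθ hθδ i _ u hu hnode hur hlen => ?_⟩
    have hlt : nodePt ρ γ (u ++ θ) < δ :=
      (nodePt_lt_iff.2 (hnode.nodeVal_append_lt hθ.ne_nil hu)).trans_le hθδ
    obtain ⟨s, m, hm, -, hs⟩ := hθ.exists_root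
    have := hK m hm
    rw [htr h hnode hl hlt, hr θ hθ.ne_nil u (by omega) hur]
    congr 1
    omega
  refine ⟨treeMap M ρ γ e '' Iio δ, hc.isSkeleton hω he, ?_, ?_, ?_⟩
  -- Components are counted from `1` and pieces from `0`; the level of a node is the exponent of its
  -- piece minus its rank.
  · refine ⟨fun m κ₂ κ₁ => D (m - 1) (γ (m - 1) - toNat κ₂) (toNat κ₂ - toNat κ₁), ?_⟩
    intro β₁ hβ₁ β₂ hβ₂ hlt
    obtain ⟨l₁, k₁, h₁, rfl⟩ := hc.exists_nodePt hω hβ₁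
    obtain ⟨l₂, k₂, h₂, rfl⟩ := hc.exists_nodePt hω hβ₂
    obtain ⟨u, hu, rfl⟩ := (hc.treeLT_nodePt_iff h₁ h₂).1 hlt
    have h3 := (h₁.of_append h₂.ne_nil).nodeRank_eq.symm.trans h₂.nodeRank_eq
    obtain ⟨s, m, hm, rfl, hs⟩ := h₂.exists_root
    have := hK m hm
    rw [Sym2.eq_swap, htr h₂ h₁ hβ₂ hβ₁, (h₁.lastTerm hc).cbRank, (h₂.lastTerm hc).cbRank,
      hc.componentIndex_nodePt hω hρ hm h₂]
    beta_reduce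
    rw [hnat, hnat, hN m s u (by omega) (by omega),
      Nat.add_sub_cancel]
    congr 1 <;> omega
  · intro α hα
    obtain ⟨l, k, h, rfl⟩ := hc.exists_nodePt hω hα
    obtain ⟨r, hr⟩ := hlarge h hα
    refine ⟨r, fun β => transport (treeMap M ρ γ e '' Iio δ) col s(nodePt ρ γ l, β),
      fun _ _ _ => rfl, ?_⟩
    intro θ hθ i hi
    obtain ⟨t, j, ht, rfl⟩ := hc.exists_nodePt hω hθ
    rw [(ht.lastTerm hc).cbRank] at hi
    obtain ⟨i, rfl⟩ := lt_omega0.1 (hi.trans (natCast_lt_omega0 j))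
    rw [Nat.cast_lt] at hi
    exact ⟨c l t (j - i), hc.isLargeAt ht hi fun u hu h1 h2 h3 =>
      hr t j ht hθ.le i hi u hu h1 h2 h3⟩
  · refine ⟨fun m κ m' κ' => E (m - 1) (γ (m - 1) - toNat κ) (m' - 1) (γ (m' - 1) - toNat κ'), ?_⟩
    intro α hα m' hm1 hm2 _ i hi
    obtain ⟨l, k, h, rfl⟩ := hc.exists_nodePt hω hα
    obtain ⟨r, hr⟩ := hlarge h hα
    obtain ⟨m', rfl⟩ := Nat.exists_eq_succ_of_ne_zero (n := m') (by omega)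
    rw [hM] at hm2
    have hroot : IsNode M γ [m'] (γ m') := .root hm2
    have hsup : sSup (component δ (m' + 1)) = nodePt ρ γ [m'] := by
      rw [hc.sSup_component hω hρ hm2 hi, ← add_right_inj (1 : Ordinal.{0}), one_add_nodePt,
        hc.nodeVal_singleton hm2, one_add_of_omega0_le (hc.omega0_le hω (by omega) hm2)]
    have hle : nodePt ρ γ [m'] ≤ δ := by
      refine le_trans (b := 1 + nodePt ρ γ [m']) le_add_self ?_
      rw [one_add_nodePt, hc.nodeVal_singleton hm2, ← hc.last]
      exact hc.mono hm2 le_rfl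
    rw [Nat.succ_eq_add_one, hsup] at hi ⊢
    rw [(hroot.lastTerm hc).cbRank] at hi
    obtain ⟨i, rfl⟩ := lt_omega0.1 (hi.trans (natCast_lt_omega0 _))
    rw [Nat.cast_lt] at hi
    obtain ⟨s, m, hm, rfl, hs⟩ := h.exists_root
    have := hK m hm
    have := hK m' hm2
    refine ⟨r, hc.isLargeAt hroot hi fun u hu h1 h2 h3 => ?_⟩
    rw [hr [m'] (γ m') hroot hle i hi u hu h1 h2 h3, (h.lastTerm hc).cbRank,
      hc.componentIndex_nodePt hω hρ hm h]
    beta_reduce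
    rw [hnat, hnat,
      hE m s (by omega) m' hm2 _ (by omega), Nat.add_sub_cancel, Nat.add_sub_cancel]
    congr 1
    omega

end Components

/-! ### The cut given by the Cantor normal form -/

theorem sum_replicate_eq_mul (x : Ordinal.{0}) (m : ℕ) : (List.replicate m x).sum = x * m := by
  induction m with
  | zero => simp
  | succ m ih =>
    rw [List.replicate_succ', List.sum_append, ih, List.sum_singleton, Nat.cast_succ, mul_add_one]

theorem sum_cnfExps (δ : Ordinal.{0}) : ((cnfExps δ).map fun γ => ω ^ γ).sum = δ := by
  have h : ∀ L : List (Ordinal.{0} × Ordinal.{0}), (∀ p ∈ L, p.2 < ω) →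
      ((L.flatMap fun p => List.replicate (Cardinal.toNat p.2.card) p.1).map fun γ => ω ^ γ).sum =
        L.foldr (fun p r => ω ^ p.1 * p.2 + r) 0 := by
    intro L hL
    induction L with
    | nil => rfl
    | cons p L ih =>
      obtain ⟨c, hc⟩ := lt_omega0.1 (hL p List.mem_cons_self)
      rw [List.flatMap_cons, List.map_append, List.sum_append, List.map_replicate,
        sum_replicate_eq_mul, ih fun q hq => hL q (List.mem_cons_of_mem _ hq), List.foldr_cons, hc,
        card_nat, Cardinal.toNat_natCast]
  rw [cnfExps, h _ fun p hp => CNF.snd_lt one_lt_omega0 hp, CNF.foldr]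

theorem pairwise_cnfExps (δ : Ordinal.{0}) : (cnfExps δ).Pairwise (· ≥ ·) := by
  rw [cnfExps, List.pairwise_flatMap]
  refine ⟨fun p _ => List.pairwise_replicate.2 (Or.inr le_rfl), ?_⟩
  have h := (CNF.sortedGT ω δ).pairwise
  rw [List.pairwise_map] at h
  refine h.imp fun {p q} hpq x hx y hy => ?_
  rw [List.eq_of_mem_replicate hx, List.eq_of_mem_replicate hy]
  exact hpq.le

theorem lt_omega0_of_mem_cnfExps {δ : Ordinal.{0}} (hδ : δ < ω ^ ω) {γ : Ordinal.{0}}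
    (h : γ ∈ cnfExps δ) : γ < ω := by
  rw [cnfExps, List.mem_flatMap] at h
  obtain ⟨p, hp, hγ⟩ := h
  rw [List.eq_of_mem_replicate hγ]
  exact (CNF.fst_le_log hp).trans_lt
    ((lt_opow_iff_log_lt' one_lt_omega0 omega0_ne_zero).1 hδ)

theorem dvd_list_sum {x : Ordinal.{0}} {L : List Ordinal.{0}} (h : ∀ y ∈ L, x ∣ y) : x ∣ L.sum := by
  induction L with
  | nil => exact dvd_zero _
  | cons y L ih =>
    rw [List.sum_cons]
    exact (dvd_add_iff (h y List.mem_cons_self)).2 (ih fun z hz => h z (List.mem_cons_of_mem _ hz))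

/-- Non-increasing exponents give the divisibility, and `δ < ω ^ ω` makes them natural numbers. -/
theorem isCut_cnfSum {δ : Ordinal.{0}} (hδ : δ < ω ^ ω) :
    IsCut δ (numComponents δ) (cnfSum δ)
      fun m => Cardinal.toNat ((cnfExps δ).getD m 0).card := by
  have hγ : ∀ m (hm : m < (cnfExps δ).length),
      ((Cardinal.toNat ((cnfExps δ).getD m 0).card : ℕ) : Ordinal.{0}) = (cnfExps δ)[m] := by
    intro m hm
    obtain ⟨c, hc⟩ := lt_omega0.1 (lt_omega0_of_mem_cnfExps hδ (List.getElem_mem hm))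
    rw [List.getD_eq_getElem _ _ hm, hc, card_nat, Cardinal.toNat_natCast]
  refine ⟨by simp [cnfSum], fun m hm => ?_, fun m hm => ?_, ?_⟩
  · rw [hγ m hm, cnfSum, cnfSum, List.take_succ_eq_append_getElem hm, List.map_append,
      List.sum_append, List.map_singleton, List.sum_singleton]
  · rw [hγ m hm, cnfSum]
    refine dvd_list_sum fun y hy => ?_
    obtain ⟨x, hx, rfl⟩ := List.mem_map.1 hy
    obtain ⟨i, hi, rfl⟩ := List.mem_take_iff_getElem.1 hx
    exact opow_dvd_opow ω (List.pairwise_iff_getElem.1 (pairwise_cnfExps δ) i m _ hm (by omega))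
  · rw [cnfSum, numComponents, List.take_length, sum_cnfExps]

/-! ### Finite ordinals -/

theorem cbRank_eq_zero {β : Ordinal.{0}} (h : β < ω) : cbRank β = 0 := by
  obtain ⟨m, rfl⟩ := lt_omega0.1 h
  exact cbRank_natCast m

theorem not_treeLT_of_lt_omega0 {α β : Ordinal.{0}} (h : β < ω) : ¬ TreeLT α β := by
  rintro ⟨γ, hγ, -, rfl⟩
  refine h.not_ge (le_trans ?_ le_add_self)
  conv_lhs => rw [← opow_one ω]
  exact opow_le_opow_right omega0_pos (Order.one_le_iff_ne_zero.2 hγ)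

theorem isCanonicalSkeleton_Iio {δ : Ordinal.{0}} (hδ : δ < ω) {n : ℕ} (hn : 0 < n)
    (col : Sym2 Ordinal.{0} → Fin n) : IsCanonicalSkeleton δ col (Iio δ) := by
  have hmono : StrictMonoOn (fun x : Ordinal.{0} => x) (Iio δ) := fun _ _ _ _ h => h
  have himage : (fun x : Ordinal.{0} => x) '' Iio δ = Iio δ := image_id' _
  have hcollapse : ∀ β < δ, collapse (Iio δ) β = β := fun β hβ => by
    have := collapse_image hmono hβ
    rwa [himage] at this
  refine ⟨⟨Subset.rfl, ?_, ?_, fun α hα β hβ => ?_⟩, ⟨fun _ _ _ => ⟨0, hn⟩, ?_⟩, ?_,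
    fun _ _ _ _ => ⟨0, hn⟩, ?_⟩
  · convert isClosed_univ
    ext x
    exact iff_of_true x.2 (mem_univ x)
  · have := otp_image hmono
    rwa [himage] at this
  · rw [hcollapse α hα, hcollapse β hβ]
  · exact fun _ _ β₂ hβ₂ h => absurd h (not_treeLT_of_lt_omega0 (hβ₂.trans hδ))
  · refine fun α _ => ⟨0, fun β => transport (Iio δ) col s(α, β), fun _ _ _ => rfl, ?_⟩
    intro θ hθ l hl
    rw [cbRank_eq_zero (hθ.trans hδ)] at hl
    exact absurd hl not_lt_zero
  · intro α _ m _ _ _ l hl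
    rw [cbRank_eq_zero ((csSup_le' fun β hβ => hβ.1.le).trans_lt hδ)] at hl
    exact absurd hl not_lt_zero

end OrdinalSkeleton

end

theorem mainTheorem4 (δ : Ordinal.{0}) (hδ : δ < Ordinal.omega0 ^ Ordinal.omega0)
    (n : ℕ) (hn : 0 < n) (col : Sym2 Ordinal.{0} → Fin n) :
    ∃ I : Set Ordinal.{0}, OrdinalSkeleton.IsCanonicalSkeleton δ col I := by
  rcases lt_or_ge δ ω with h | h
  · exact ⟨_, OrdinalSkeleton.isCanonicalSkeleton_Iio h hn col⟩
  · exact (OrdinalSkeleton.isCut_cnfSum hδ).exists_canonicalSkeleton h (fun _ => rfl) rfl hn col
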